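/- Let $\mathcal O=\mathbb C[[t]]$, $\mathcal K=\mathbb C((t))$. The $A_2$ affine building $\Delta_2$ is the flag complex whose vertices are the homothety classes $[L]$ ($L\sim t^kL$, $k\in\mathbb Z$) of $\mathcal O$-lattices $L\subset\mathcal K^3$, where $[L],[L']$ are adjacent if they have representatives with $tL\subsetneq L'\subsetneq L$. For vertices $x,y$ write $d(x,y)=\mu$, where $\mu_1\ge\mu_2\ge\mu_3$ are integers considered modulo $(1,1,1)$, if some basis $v_1,v_2,v_3$ of $\mathcal K^3$ satisfies $x=[\langle v_1,v_2,v_3\rangle_{\mathcal O}]$ and $y=[\langle t^{-\mu_1}v_1,t^{-\mu_2}v_2,t^{-\mu_3}v_3\rangle_{\mathcal O}]$. Put $\omega_1=(1,0,0)$ and $\omega_2=(1,1,0)$. For a set $S$ of vertices, $\mathrm{conv}(S)$ is the intersection of the smallest set of vertices that contains $S$ and is closed under intersections of lattice representatives with the smallest set of vertices that contains $S$ and is closed under sums of lattice representatives. Let $n\ge 1$ and let $P=(x_1,\dots,x_n)$ be a polygon: $d(x_i,x_{i+1})\in\{\omega_1,\omega_2\}$ for all $i$, indices modulo $n$. Assume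 that $P$ is generic: there are $k\ge 0$ and partitions $\gamma_{i,j}$ with at most three parts ($1\le i\le n+1$, $i\le j\le i+n$) that represent the weights $d(x_i,x_j)$ and form a cylindrical growth diagram, that is, $\gamma_{i,i}=\emptyset$, $\gamma_{i,i+n}=(k,k,k)$, the skew shapes $\gamma_{i,j}/\gamma_{i+1,j}$ and $\gamma_{i,j}/\gamma_{i,j-1}$ are vertical strips, and $\gamma_{i+1,j+1}=\mathrm{sort}(\gamma_{i+1,j}+\gamma_{i,j+1}-\gamma_{i,j})$ on every unit square. Then the subcomplex of $\Delta_2$ induced on the vertex set $\mathrm{conv}(P)$ is a triangulated diskoid with boundary $P$: it embeds in the sphere so that one complementary face has $P$ as its closed boundary walk and the other faces are exactly its $2$-simplices. Every vertex of it that is not a vertex of $P$ (every interior vertex) has degree at least $6$, so that it is $\mathrm{CAT}(0)$. Its planar dual, with the edges of the diskoid directed as $\omega_1$-steps and each dual edge directed so that counterclockwise rotation gives the direction of the edge it crosses, is a non-elliptic $A_2$ web with $n$ boundary vertices: a directed plane graph in a disk without multiple edges, whose interior vertices are trivalent and are sources or sinks, whose boundary vertices are univalent, and all of whose internal faces have at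 least $6$ sides. -/

import Mathlib

noncomputable section

namespace A2

open scoped Pointwise

/-! ### Lattices and the vertices of the affine building of type `A₂` -/

/-- The discrete valuation ring `ℂ[[t]]`. -/
abbrev O : Type := PowerSeries ℂ

/-- The field of Laurent series `ℂ((t))`. -/
abbrev K : Type := LaurentSeries ℂ

/-- The vector space `ℂ((t))³`. -/
abbrev U : Type := Fin 3 → K

/-- The uniformizer `t`, as a unit of `ℂ((t))`. -/
def t : Kˣ := Units.mk0 (HahnSeries.single (1 : ℤ) (1 : ℂ)) (by simp)

/-- An `O`-lattice in `U`: a finitely generated `O`-submodule whose `K`-span is all of `U`. -/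
structure OLattice where
  carrier : Submodule O U
  isLattice : Submodule.IsLattice K carrier

namespace OLattice

/-- The intersection of two lattices. -/
def inter (L M : OLattice) : OLattice :=
  ⟨L.carrier ⊓ M.carrier, by
    have := L.isLattice
    have := M.isLattice
    exact Submodule.IsLattice.inf K L.carrier M.carrier⟩

/-- The sum of two lattices. -/
def sum (L M : OLattice) : OLattice :=
  ⟨L.carrier ⊔ M.carrier, by
    have := L.isLattice
    have := M.isLattice
    exact Submodule.IsLattice.sup K L.carrier M.carrier⟩

/-- The `O`-span of a `K`-basis of `U`. -/
def ofBasis (b : Module.Basis (Fin 3) K U) : OLattice :=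
  ⟨Submodule.span O (Set.range b), Submodule.fg_span (Set.finite_range b), by
    rw [Submodule.span_span_of_tower]
    exact b.span_eq⟩

/-- Two lattices are homothetic if one is `t ^ k` times the other for some integer `k`. -/
instance homothety : Setoid OLattice where
  r L M := ∃ k : ℤ, M.carrier = t ^ k • L.carrier
  iseqv :=
    { refl := fun L => ⟨0, by simp⟩
      symm := by
        rintro L M ⟨k, hk⟩
        exact ⟨-k, by rw [hk, smul_smul, ← zpow_add]; simp⟩
      trans := by
        rintro L M N ⟨k, hk⟩ ⟨l, hl⟩
        exact ⟨l + k, by rw [hl, hk, smul_smul, ← zpow_add]⟩ }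

end OLattice

/-- The vertices of the building: homothety classes of lattices. -/
def Vertex : Type := Quotient OLattice.homothety

/-- The homothety class `[L]` of a lattice `L`. -/
def cls (L : OLattice) : Vertex := Quotient.mk OLattice.homothety L

/-- Adjacency in the building: there are representatives with `t L ⊂ M ⊂ L` (strict inclusions). -/
def Adj (x y : Vertex) : Prop :=
  ∃ L M : OLattice, cls L = x ∧ cls M = y ∧ t • L.carrier < M.carrier ∧ M.carrier < L.carrier

/-- The `A₂` affine building: the flag complex of the adjacency relation on vertices. -/
def building : PreAbstractSimplicialComplex Vertex where
  faces := {s | s.Nonempty ∧ (s : Set Vertex).Pairwise Adj}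
  isRelLowerSet_faces := by
    rintro s ⟨hs, hp⟩
    exact ⟨hs, fun u hu hne => ⟨hne, hp.mono (by exact_mod_cast hu)⟩⟩

/-- `HasDist x y μ` says that the dominant-weight-valued distance `d(x, y)` is the class of the
weakly decreasing triple `μ` modulo `(1, 1, 1)`: in some basis `v`, the vertex `x` is the class of
the lattice spanned by the `v i`, and `y` the class of the lattice spanned by the
`t ^ (-μ i) v i`. -/
def HasDist (x y : Vertex) (μ : Fin 3 → ℤ) : Prop :=
  Antitone μ ∧ ∃ v : Module.Basis (Fin 3) K U,
    x = cls (OLattice.ofBasis v) ∧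
    y = cls (OLattice.ofBasis (v.unitsSMul fun i => t ^ (-μ i)))

/-- The fundamental weight `ω₁`. -/
def omega1 : Fin 3 → ℤ := ![1, 0, 0]

/-- The fundamental weight `ω₂`. -/
def omega2 : Fin 3 → ℤ := ![1, 1, 0]

/-! ### Convex hulls -/

/-- A set of lattice classes is min-convex if it is closed under intersections of representatives
(closure under binary intersections gives closure under all nonempty finite ones). -/
def MinConvex (X : Set Vertex) : Prop :=
  ∀ L M : OLattice, cls L ∈ X → cls M ∈ X → cls (L.inter M) ∈ X

/-- A set of lattice classes is max-convex if it is closed under sums of representatives. -/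
def MaxConvex (X : Set Vertex) : Prop :=
  ∀ L M : OLattice, cls L ∈ X → cls M ∈ X → cls (L.sum M) ∈ X

/-- The smallest min-convex set containing `S`. -/
def minconv (S : Set Vertex) : Set Vertex := ⋂₀ {X | MinConvex X ∧ S ⊆ X}

/-- The smallest max-convex set containing `S`. -/
def maxconv (S : Set Vertex) : Set Vertex := ⋂₀ {X | MaxConvex X ∧ S ⊆ X}

/-- The intersection of the min-convex hull and the max-convex hull. -/
def conv (S : Set Vertex) : Set Vertex := minconv S ∩ maxconv S

/-! ### Generic polygons -/

/-- A closed polygon with `n` vertices, indexed cyclically, all of whose consecutive distances are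
fundamental weights. -/
def IsPolygon {n : ℕ} (P : ZMod n → Vertex) : Prop :=
  ∀ i, HasDist (P i) (P (i + 1)) omega1 ∨ HasDist (P i) (P (i + 1)) omega2

/-- A partition with at most three parts. -/
def IsPartition (μ : Fin 3 → ℤ) : Prop := Antitone μ ∧ ∀ r, 0 ≤ μ r

/-- The skew shape `μ / ν` is a vertical strip. -/
def IsVerticalStrip (μ ν : Fin 3 → ℤ) : Prop := ∀ r, ν r ≤ μ r ∧ μ r ≤ ν r + 1

/-- The index set `1 ≤ i ≤ n + 1`, `i ≤ j ≤ i + n` of a cylindrical growth diagram. -/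
def staircase (n : ℕ) : Set (ℕ × ℕ) :=
  {p | 1 ≤ p.1 ∧ p.1 ≤ n + 1 ∧ p.1 ≤ p.2 ∧ p.2 ≤ p.1 + n}

/-- Cylindrical growth diagrams for `SL₃` of shape `(k, k, k)`. Only the values of `γ` on the
staircase matter. -/
structure IsGrowthDiagram (n k : ℕ) (γ : ℕ → ℕ → Fin 3 → ℤ) : Prop where
  partition : ∀ i j, (i, j) ∈ staircase n → IsPartition (γ i j)
  strip_row : ∀ i j, (i, j) ∈ staircase n → (i + 1, j) ∈ staircase n →
    IsVerticalStrip (γ i j) (γ (i + 1) j)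
  strip_col : ∀ i j, (i, j) ∈ staircase n → (i, j + 1) ∈ staircase n →
    IsVerticalStrip (γ i (j + 1)) (γ i j)
  diag : ∀ i, (i, i) ∈ staircase n → ∀ r, γ i i r = 0
  shape : ∀ i, (i, i + n) ∈ staircase n → ∀ r, γ i (i + n) r = k
  /-- The partition `γ (i + 1) (j + 1)` is the decreasing rearrangement of
  `γ (i + 1) j + γ i (j + 1) - γ i j`. -/
  sort : ∀ i j, (i, j) ∈ staircase n → (i, j + 1) ∈ staircase n → (i + 1, j) ∈ staircase n →
    (i + 1, j + 1) ∈ staircase n → ∃ σ : Equiv.Perm (Fin 3), ∀ r,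
      γ (i + 1) (j + 1) r = γ (i + 1) j (σ r) + γ i (j + 1) (σ r) - γ i j (σ r)

/-- A polygon is generic if its pairwise distances, for suitable representing partitions, form a
cylindrical growth diagram (indices of vertices are read modulo `n`). -/
def IsGeneric {n : ℕ} (P : ZMod n → Vertex) : Prop :=
  ∃ (k : ℕ) (γ : ℕ → ℕ → Fin 3 → ℤ), IsGrowthDiagram n k γ ∧
    ∀ i j, (i, j) ∈ staircase n → HasDist (P i) (P j) (γ i j)

end A2

/-! ### Planar maps, triangulated diskoids and webs -/

namespace Planar

/-- A connected planar (spherical) map, given combinatorially by its half-edges: `flip` sends a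
half-edge to the opposite half-edge of the same edge and `rot` to the next half-edge around its
vertex. Vertices, edges and faces are the cycles of `rot`, `flip` and `rot * flip`, and the
surface obtained is the sphere when `V + F = E + 2`. -/
structure IsPlanarMap {D : Type} (flip rot : Equiv.Perm D) : Prop where
  finite : Finite D
  flip_flip : ∀ d, flip (flip d) = d
  flip_ne : ∀ d, flip d ≠ d
  connected : ∀ d e, Relation.ReflTransGen (fun a b => b = flip a ∨ b = rot a) d e
  euler : Nat.card (Quotient (Equiv.Perm.SameCycle.setoid rot)) +
      Nat.card (Quotient (Equiv.Perm.SameCycle.setoid (rot * flip))) =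
    Nat.card (Quotient (Equiv.Perm.SameCycle.setoid flip)) + 2

variable {V : Type}

/-- The subcomplex induced on a set of vertices. -/
def induced (C : PreAbstractSimplicialComplex V) (S : Set V) : PreAbstractSimplicialComplex V where
  faces := {s | s ∈ C.faces ∧ (s : Set V) ⊆ S}
  isRelLowerSet_faces := by
    rintro s ⟨hs, hS⟩
    refine ⟨(C.isRelLowerSet_faces hs).1, fun u hu hne => ⟨?_, ?_⟩⟩
    · exact (C.isRelLowerSet_faces hs).2 hu hne
    · exact fun x hx => hS (hu hx)

/-- The set `s` is (the vertex set of) a simplex of `C`. -/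
def IsFace (C : PreAbstractSimplicialComplex V) (s : Set V) : Prop :=
  ∃ u ∈ C.faces, (u : Set V) = s

/-- The edges of `C` with a direction of traversal. -/
def Dart (C : PreAbstractSimplicialComplex V) : Type :=
  {d : V × V // d.1 ≠ d.2 ∧ IsFace C {d.1, d.2}}

/-- The same edge traversed in the opposite direction. -/
def rev (C : PreAbstractSimplicialComplex V) : Equiv.Perm (Dart C) where
  toFun d := ⟨(d.1.2, d.1.1), d.2.1.symm, Set.pair_comm d.1.1 d.1.2 ▸ d.2.2⟩
  invFun d := ⟨(d.1.2, d.1.1), d.2.1.symm, Set.pair_comm d.1.1 d.1.2 ▸ d.2.2⟩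
  left_inv _ := rfl
  right_inv _ := rfl

/-- The structure of a triangulated diskoid with boundary polygon `P` on a simplicial complex `C`:
an embedding of `C` in the sphere, such that one complementary face (the outer one) has the closed
walk `P` as its boundary walk and the other faces are exactly the `2`-simplices of `C`.

The embedding is given by the permutation `next` of the directed edges, which sends a directed edge
to its successor along the boundary of the face to its left. Viewed in the plane, with the outer
face unbounded, `P` runs clockwise around `C`. -/
structure TriangulatedDiskoid (C : PreAbstractSimplicialComplex V) {n : ℕ} (P : ZMod n → V) where
  next : Equiv.Perm (Dart C)
  next_fst : ∀ d, (next d).1.1 = d.1.2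
  /-- The directed edges of the polygon; they form a single face. -/
  bdry : ZMod n → Dart C
  bdry_val : ∀ i, (bdry i).1 = (P i, P (i + 1))
  bdry_injective : Function.Injective bdry
  next_bdry : ∀ i, next (bdry i) = bdry (i + 1)
  /-- The other faces are triangles, and they correspond bijectively to the `2`-simplices. -/
  next_three : ∀ d, d ∉ Set.range bdry → next (next (next d)) = d
  isFace : ∀ d, d ∉ Set.range bdry → IsFace C {d.1.1, d.1.2, (next d).1.2}
  exists_triangle : ∀ s ∈ C.faces, s.card = 3 →
    ∃ d, d ∉ Set.range bdry ∧ (s : Set V) = {d.1.1, d.1.2, (next d).1.2}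
  triangle_unique : ∀ d e, d ∉ Set.range bdry → e ∉ Set.range bdry →
    ({d.1.1, d.1.2, (next d).1.2} : Set V) = {e.1.1, e.1.2, (next e).1.2} → next.SameCycle d e
  card_le : ∀ s ∈ C.faces, s.card ≤ 3
  /-- No vertex is isolated, and turning around a vertex meets all directed edges leaving it. -/
  exists_dart : ∀ v, IsFace C {v} → ∃ d : Dart C, d.1.1 = v
  rot_cycle : ∀ d e : Dart C, d.1.1 = e.1.1 → (next * rev C).SameCycle d e
  planar : IsPlanarMap (rev C) (next * rev C)

/-- The degree of a vertex in the `1`-skeleton of `C`. -/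
def degree (C : PreAbstractSimplicialComplex V) (v : V) : ℕ :=
  {w | w ≠ v ∧ IsFace C {v, w}}.ncard

/-- The `CAT(0)` condition for a triangulated diskoid `C` with boundary `P`: all vertices that do
not lie on the boundary have degree at least `6`. -/
def IsCAT0 (C : PreAbstractSimplicialComplex V) {n : ℕ} (P : ZMod n → V) : Prop :=
  ∀ v, IsFace C {v} → v ∉ Set.range P → 6 ≤ degree C v

/-- An `A₂` web in a disk with `n ≥ 1` univalent vertices on the boundary circle, all of whose
components meet the boundary circle. `flip` is as for planar maps, `rot` is the
counterclockwise rotation around the vertices of the web, and `out h` says that the edge of the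
half-edge `h` is directed away from the vertex of `h`. Collapsing the boundary circle to
a point gives a map on the sphere, with rotation `closedRot`, in which the boundary half-edges, in
the clockwise order of their end points on the boundary circle, form one further vertex. -/
structure Web (n : ℕ) where
  HalfEdge : Type
  flip : Equiv.Perm HalfEdge
  rot : Equiv.Perm HalfEdge
  out : HalfEdge → Prop
  out_flip : ∀ h, out (flip h) ↔ ¬ out h
  /-- The half-edges at the univalent boundary vertices. -/
  bdry : ZMod n → HalfEdge
  bdry_injective : Function.Injective bdry
  rot_bdry : ∀ i, rot (bdry i) = bdry i
  /-- Interior vertices are trivalent, and each of them is a source or a sink. -/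
  trivalent : ∀ h, h ∉ Set.range bdry → rot h ≠ h ∧ rot (rot (rot h)) = h
  out_rot : ∀ h, out (rot h) ↔ out h
  /-- There are no multiple edges. -/
  simple : ∀ h h₁, rot.SameCycle h h₁ → rot.SameCycle (flip h) (flip h₁) → h = h₁
  closedRot : Equiv.Perm HalfEdge
  closedRot_bdry : ∀ i, closedRot (bdry i) = bdry (i + 1)
  closedRot_of_notMem : ∀ h, h ∉ Set.range bdry → closedRot h = rot h
  planar : IsPlanarMap flip closedRot

/-- A web is non-elliptic if every internal face (a face that does not meet the boundary circle)
has at least `6` sides. -/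
def Web.NonElliptic {n : ℕ} (W : Web n) : Prop :=
  ∀ h, (∀ h₁, (W.closedRot * W.flip).SameCycle h h₁ → h₁ ∉ Set.range W.bdry) →
    6 ≤ {h₁ | (W.closedRot * W.flip).SameCycle h h₁}.ncard

/-- `W` is the web dual to the triangulated diskoid `T` whose edges are directed by `dir`: it has
one trivalent vertex for each triangle and one boundary vertex for each edge of the boundary
polygon, and one edge crossing each edge of `T`. The half-edge dual to the directed edge `u → v`
starts in the face to the left of `u → v`; the direction of an edge of `T` is
that of the dual web edge rotated counterclockwise. -/
def TriangulatedDiskoid.IsDual {C : PreAbstractSimplicialComplex V} {n : ℕ} {P : ZMod n → V}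
    (T : TriangulatedDiskoid C P) (dir : V → V → Prop) (W : Web n) : Prop :=
  ∃ e : Dart C ≃ W.HalfEdge,
    (∀ d, e (rev C d) = W.flip (e d)) ∧
    (∀ i, e (T.bdry i) = W.bdry i) ∧
    (∀ d, d ∉ Set.range T.bdry → e (T.next d) = W.rot (e d)) ∧
    (∀ d, W.out (e d) ↔ dir d.1.1 d.1.2)

end Planar

end

/-!
The vertices of the building carry a directed distance `F x y`, the colength of the largest
representative of `y` inside a representative of `x`. It satisfies the triangle inequality, it
equals `dim L / M` on edges `t L ⊂ M ⊂ L`, and an inclusion `M ⊆ L` of lattices is the inequality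
`F [L] [M] ≤ deg M - deg L`. All geometric input is expressed by `F`. Two facts on an edge from `x
= [L]` to `y = [M]`, with `dim L / M = 1`, are basic. If the edge leads towards `a` and away from
`b`, then `x` lies on a shortest path from `a` to `b` (`Step.F_eq_add`); and a vertex `c` on
neither of these two sides spans with the edge a unique triangle in its direction
(`Step.exists_third`, `Step.third_unique`).

The local rule of the growth diagram enters only through its effect on first parts. Sorting does
not decrease the first entry, so the distances `F (P i) (P j)` satisfy the four-point inequality
of a convex polygon (`fourPoint_of_isGeneric`).

A triangle of the hull is given a cyclic orientation by the order in which its three vertices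
occur as the closest ones while one runs through `P` (`Tri`). This is well defined: by the
four-point inequality, the labels recording the closest vertex from `P i` and the closest vertex
to `P i` do not cross, so that both cyclic orders cannot occur (`Noncrossing.not_ordNeg`,
`FourPoint.not_tri_swap`). A directed edge of the hull is either an edge of `P` or has exactly one
triangle to its left (`FourPoint.exists_tri`, `FourPoint.tri_unique`, `FourPoint.not_tri_bdry`).
Hence following left faces is a permutation of the directed edges, whose cycles are `P` and the
triangles.

To see that this is an embedding in the sphere, contract the hull towards a vertex `o` of `P`. The
neighbours of a vertex `v ≠ o` that are closer to `o` form a nonempty star (`exists_gate`). As `o`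
moves along `P`, these stars are nested, so that turning around `v` meets all edges at `v`
(`FourPoint.rot_cycle`). Moreover the edges from `v` to the centres of the stars correspond to the
vertices other than `o`, and the remaining edges of the stars to the triangles, which is Euler's
formula (`FourPoint.euler`).

An edge at a vertex `v = [L]` off `P` lies in two triangles. The link of `v` in the building is
the incidence graph of the projective plane of `L / t L`, which has girth six, so `v` has at least
six neighbours in the hull (`FourPoint.exists_six`). The dual web has the same half-edges as the
diskoid, with the roles of vertices and faces exchanged.
-/

namespace A2

open scoped Pointwise
open Module OLattice

/-! ### Integrality in the field of Laurent series -/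

/-- The subring `ℂ[[t]]` of `ℂ((t))`. -/
noncomputable def integers : Subring K := (algebraMap O K).range

theorem mem_integers_iff (x : K) : x ∈ integers ↔ x = 0 ∨ 0 ≤ x.order := by
  constructor
  · rintro ⟨a, rfl⟩
    by_cases h : (algebraMap O K a) = 0
    · exact Or.inl h
    · right
      by_contra hlt
      push Not at hlt
      apply HahnSeries.coeff_order_eq_zero.not.2 h
      rw [LaurentSeries.coe_algebraMap, PowerSeries.coeff_coe]
      exact if_pos hlt
  · rintro (rfl | h)
    · exact zero_mem _
    · refine ⟨PowerSeries.X ^ x.order.toNat * x.powerSeriesPart, ?_⟩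
      rw [LaurentSeries.coe_algebraMap]
      exact LaurentSeries.X_order_mul_powerSeriesPart (Int.toNat_of_nonneg h)

theorem order_t_zpow (k : ℤ) : ((t ^ k : Kˣ) : K).order = k := by
  have : ((t ^ k : Kˣ) : K) = HahnSeries.single k 1 := by
    rw [Units.val_zpow_eq_zpow_val]
    show (HahnSeries.single (1 : ℤ) (1 : ℂ)) ^ k = _
    exact (RatFunc.single_zpow k).symm
  rw [this, HahnSeries.order_single one_ne_zero]

theorem t_zpow_mem_integers_iff (k : ℤ) : ((t ^ k : Kˣ) : K) ∈ integers ↔ 0 ≤ k := by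
  rw [mem_integers_iff, order_t_zpow]
  exact or_iff_right (Units.ne_zero _)

theorem smul_eq_algebraMap_smul (a : O) (x : U) : a • x = (algebraMap O K a) • x := by
  exact algebra_compatible_smul K a x

theorem exists_zpow_mul_mem_integers (x : K) :
    ∃ m : ℤ, ∀ k, m ≤ k → ((t ^ k : Kˣ) : K) * x ∈ integers := by
  refine ⟨-x.order, fun k hk => ?_⟩
  rw [mem_integers_iff]
  by_cases hx : x = 0
  · simp [hx]
  · right
    rw [HahnSeries.order_mul (Units.ne_zero _) hx, order_t_zpow]
    omega

/-! ### Lattices and bases -/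

namespace OLattice

theorem mem_ofBasis (v : Basis (Fin 3) K U) (x : U) :
    x ∈ (ofBasis v).carrier ↔ ∀ i, v.repr x i ∈ integers := by
  constructor
  · intro hx i
    induction hx using Submodule.span_induction with
    | mem x h =>
      obtain ⟨j, rfl⟩ := h
      rw [Basis.repr_self, Finsupp.single_apply]
      split_ifs
      · exact one_mem _
      · exact zero_mem _
    | zero => simp
    | add x y _ _ hx hy => simpa using add_mem hx hy
    | smul a x _ hx =>
      rw [smul_eq_algebraMap_smul]
      rw [map_smul, Finsupp.smul_apply, smul_eq_mul]
      exact mul_mem (show _ ∈ (algebraMap O K).range from ⟨a, rfl⟩) hx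
  · intro h
    rw [← v.sum_repr x]
    refine Submodule.sum_mem _ fun i _ => ?_
    obtain ⟨a, ha⟩ := h i
    rw [← ha, ← smul_eq_algebraMap_smul]
    exact Submodule.smul_mem _ _ (Submodule.subset_span ⟨i, rfl⟩)

theorem exists_ofBasis (L : OLattice) :
    ∃ v : Basis (Fin 3) K U, (ofBasis v).carrier = L.carrier := by
  have := L.isLattice
  have hf : Module.finrank O L.carrier = 3 := by
    simpa using Submodule.IsLattice.finrank_of_pi K L.carrier
  let b : Basis (Fin 3) O L.carrier := Module.finBasisOfFinrankEq O L.carrier hf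
  refine ⟨b.extendOfIsLattice K, ?_⟩
  show Submodule.span O _ = _
  have : Set.range (b.extendOfIsLattice K) = L.carrier.subtype '' Set.range b := by
    rw [← Set.range_comp]; congr 1; ext i; simp
  rw [this, ← Submodule.map_span, b.span_eq, Submodule.map_top, Submodule.range_subtype]

@[ext] theorem ext {L M : OLattice} (h : L.carrier = M.carrier) : L = M := by
  cases L; cases M; simp_all

noncomputable instance : PartialOrder OLattice := PartialOrder.lift carrier fun _ _ => ext

theorem le_def {L M : OLattice} : L ≤ M ↔ L.carrier ≤ M.carrier := Iff.rfl
theorem lt_def {L M : OLattice} : L < M ↔ L.carrier < M.carrier := Iff.rfl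

/-- The lattice `t ^ k L`. -/
noncomputable def scale (k : ℤ) (L : OLattice) : OLattice :=
  ⟨t ^ k • L.carrier, by have := L.isLattice; exact Submodule.IsLattice.smul K L.carrier _⟩

theorem scale_zero (L : OLattice) : L.scale 0 = L := by
  ext1; simp [scale]

theorem scale_scale (k l : ℤ) (L : OLattice) : (L.scale l).scale k = L.scale (k + l) := by
  ext1; simp [scale, smul_smul, zpow_add]

theorem mem_scale {k : ℤ} {L : OLattice} {x : U} :
    x ∈ (L.scale k).carrier ↔ ((t ^ (-k) : Kˣ) : K) • x ∈ L.carrier := by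
  show x ∈ t ^ k • L.carrier ↔ _
  constructor
  · rintro ⟨y, hy, rfl⟩
    show ((t ^ (-k) : Kˣ) : K) • (((t ^ k : Kˣ) : K) • y) ∈ L.carrier
    rw [smul_smul, ← Units.val_mul, ← zpow_add]
    simpa using hy
  · intro h
    refine ⟨_, h, ?_⟩
    show ((t ^ k : Kˣ) : K) • (((t ^ (-k) : Kˣ) : K) • x) = x
    rw [smul_smul, ← Units.val_mul, ← zpow_add]
    simp

theorem scale_mono {L M : OLattice} (k : ℤ) (h : L ≤ M) : L.scale k ≤ M.scale k := by
  intro x hx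
  rw [mem_scale] at hx ⊢
  exact h hx

theorem scale_le_scale_iff {L M : OLattice} (k : ℤ) : L.scale k ≤ M.scale k ↔ L ≤ M := by
  refine ⟨fun h => ?_, scale_mono k⟩
  simpa [scale_scale, scale_zero] using scale_mono (-k) h

theorem zpow_smul_mem {L : OLattice} {x : U} (hx : x ∈ L.carrier) {k : ℤ} (hk : 0 ≤ k) :
    ((t ^ k : Kˣ) : K) • x ∈ L.carrier := by
  obtain ⟨a, ha⟩ := (t_zpow_mem_integers_iff k).2 hk
  rw [← ha, ← smul_eq_algebraMap_smul]
  exact L.carrier.smul_mem a hx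

theorem scale_le_self_iff {L : OLattice} {k : ℤ} : L.scale k ≤ L ↔ 0 ≤ k := by
  constructor
  · intro h
    obtain ⟨v, hv⟩ := L.exists_ofBasis
    have h0 : v 0 ∈ L.carrier := by rw [← hv]; exact Submodule.subset_span ⟨0, rfl⟩
    have h1 : ((t ^ k : Kˣ) : K) • v 0 ∈ L.carrier := by
      apply h
      rw [mem_scale, smul_smul, ← Units.val_mul, ← zpow_add]
      simpa using h0
    rw [← hv, mem_ofBasis] at h1
    rw [← t_zpow_mem_integers_iff]
    simpa using h1 0
  · intro hk x hx
    rw [mem_scale] at hx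
    have := zpow_smul_mem hx hk
    rw [smul_smul, ← Units.val_mul, ← zpow_add] at this
    simpa using this

/-- Any two lattices are commensurable. -/
theorem exists_scale_le (L M : OLattice) : ∃ k : ℤ, M.scale k ≤ L := by
  obtain ⟨v, hv⟩ := L.exists_ofBasis
  obtain ⟨w, hw⟩ := M.exists_ofBasis
  have hm : ∀ i j, ∃ m : ℤ, ∀ k, m ≤ k → ((t ^ k : Kˣ) : K) * v.repr (w i) j ∈ integers :=
    fun i j => exists_zpow_mul_mem_integers _
  choose m hm using hm
  obtain ⟨k, hk⟩ : ∃ k, ∀ i j, m i j ≤ k := by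
    refine ⟨∑ i, ∑ j, |m i j|, fun i j => (le_abs_self _).trans ?_⟩
    refine (Finset.single_le_sum (f := fun j => |m i j|) (fun _ _ => abs_nonneg _)
      (Finset.mem_univ j)).trans ?_
    exact Finset.single_le_sum (f := fun i => ∑ j, |m i j|)
      (fun _ _ => Finset.sum_nonneg fun _ _ => abs_nonneg _) (Finset.mem_univ i)
  refine ⟨k, fun x hx => ?_⟩
  have hx' : ∃ y ∈ M.carrier, ((t ^ k : Kˣ) : K) • y = x := by
    rw [mem_scale] at hx
    exact ⟨_, hx, by rw [smul_smul, ← Units.val_mul, ← zpow_add]; simp⟩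
  obtain ⟨y, hy, rfl⟩ := hx'
  rw [← hw] at hy
  clear hx
  induction hy using Submodule.span_induction with
  | mem y h =>
    obtain ⟨i, rfl⟩ := h
    rw [← hv, mem_ofBasis]
    intro j
    simpa using hm i j k (hk i j)
  | zero => simp
  | add x y _ _ hx hy =>
    have := add_mem hx hy
    rwa [← smul_add (M := K) (A := U)] at this
  | smul a x _ hx =>
    have := L.carrier.smul_mem a hx
    rwa [smul_eq_algebraMap_smul, smul_smul, mul_comm, ← smul_smul,
      ← smul_eq_algebraMap_smul] at this

end OLattice

/-! ### Degrees of lattices -/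

theorem inv_mem_integers {x : K} (hx : x ≠ 0) (h : x.order = 0) : x⁻¹ ∈ integers := by
  rw [mem_integers_iff]
  right
  have h1 : x * x⁻¹ = 1 := mul_inv_cancel₀ hx
  have h2 := congrArg HahnSeries.order h1
  rw [HahnSeries.order_mul hx (inv_ne_zero hx), h, HahnSeries.order_one] at h2
  omega

theorem adjugate_eq_det_smul {k : Type*} [CommRing k] {A B : Matrix (Fin 3) (Fin 3) k}
    (h : A * B = 1) : A.adjugate = A.det • B := by
  have h2 : A.adjugate * (A * B) = A.adjugate := by rw [h, mul_one]
  rw [← mul_assoc, Matrix.adjugate_mul, smul_mul_assoc, one_mul] at h2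
  exact h2.symm

namespace OLattice

/-- The `t`-adic order of the determinant of a basis of `U`. -/
noncomputable def ordDet (v : Basis (Fin 3) K U) : ℤ := ((Pi.basisFun K (Fin 3)).det v).order

theorem det_ne_zero (v w : Basis (Fin 3) K U) : w.det v ≠ 0 := (w.isUnit_det v).ne_zero

theorem ordDet_eq_add (v w : Basis (Fin 3) K U) :
    ordDet v = ordDet w + (w.det v).order := by
  rw [ordDet, ordDet, ← HahnSeries.order_mul (det_ne_zero _ _) (det_ne_zero _ _)]
  congr 1
  rw [Basis.det_apply, Basis.det_apply, Basis.det_apply, ← Matrix.det_mul,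
    Basis.toMatrix_mul_toMatrix]

theorem exists_map_eq_toMatrix {v w : Basis (Fin 3) K U}
    (h : (ofBasis v).carrier ≤ (ofBasis w).carrier) :
    ∃ B : Matrix (Fin 3) (Fin 3) O, (algebraMap O K).mapMatrix B = w.toMatrix v := by
  have h1 : ∀ i j, ∃ a : O, algebraMap O K a = w.toMatrix v i j := fun i j =>
    (mem_ofBasis w (v j)).1 (h (Submodule.subset_span ⟨j, rfl⟩)) i
  choose B hB using h1
  exact ⟨Matrix.of B, by ext1 i j; exact hB i j⟩

theorem ordDet_le {v w : Basis (Fin 3) K U}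
    (h : (ofBasis v).carrier ≤ (ofBasis w).carrier) : ordDet w ≤ ordDet v := by
  obtain ⟨B, hB⟩ := exists_map_eq_toMatrix h
  have h1 : w.det v ∈ integers := by
    rw [Basis.det_apply, ← hB, ← RingHom.map_det]
    exact ⟨_, rfl⟩
  rw [mem_integers_iff] at h1
  have := ordDet_eq_add v w
  rcases h1 with h1 | h1
  · exact absurd h1 (det_ne_zero _ _)
  · omega

/-- An inclusion of lattices whose determinants have the same order is an equality: by Cramer's rule
the inverse of the transition matrix is integral. -/
theorem ofBasis_le_of_ordDet_eq {v w : Basis (Fin 3) K U}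
    (h : (ofBasis v).carrier ≤ (ofBasis w).carrier) (hd : ordDet v = ordDet w) :
    (ofBasis w).carrier ≤ (ofBasis v).carrier := by
  obtain ⟨B, hB⟩ := exists_map_eq_toMatrix h
  have h0 : (w.det v).order = 0 := by have := ordDet_eq_add v w; omega
  obtain ⟨c, hc⟩ := inv_mem_integers (det_ne_zero v w) h0
  have h1 : (w.toMatrix v).det • v.toMatrix w = (algebraMap O K).mapMatrix B.adjugate := by
    rw [RingHom.map_adjugate, hB]
    exact (adjugate_eq_det_smul (Basis.toMatrix_mul_toMatrix_flip _ _)).symm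
  have h2 : v.toMatrix w = (algebraMap O K).mapMatrix (c • B.adjugate) := by
    ext1 i j
    have h3 := congrFun (congrFun h1 i) j
    rw [Matrix.smul_apply, smul_eq_mul, ← Basis.det_apply] at h3
    have h4 : v.toMatrix w i j = (w.det v)⁻¹ * (w.det v * v.toMatrix w i j) := by
      rw [← mul_assoc, inv_mul_cancel₀ (det_ne_zero _ _), one_mul]
    rw [h4, h3, ← hc]
    show _ = algebraMap O K (c * B.adjugate i j)
    rw [map_mul]
    rfl
  refine Submodule.span_le.2 ?_
  rintro _ ⟨j, rfl⟩
  refine (mem_ofBasis _ _).2 fun i => ⟨(c • B.adjugate) i j, ?_⟩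
  exact (congrFun (congrFun h2 i) j).symm

theorem ordDet_unitsSMul (v : Basis (Fin 3) K U) (k : Fin 3 → ℤ) :
    ordDet (v.unitsSMul fun i => t ^ k i) = ordDet v + ∑ i, k i := by
  rw [ordDet_eq_add _ v]
  congr 1
  rw [Basis.det_unitsSMul_self, Fin.prod_univ_three, Fin.sum_univ_three, HahnSeries.order_mul,
    HahnSeries.order_mul, order_t_zpow, order_t_zpow, order_t_zpow]
  all_goals first | exact Units.ne_zero _ | exact mul_ne_zero (Units.ne_zero _) (Units.ne_zero _)

/-- The degree of a lattice: the order of the determinant of any of its bases. -/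
noncomputable def deg (L : OLattice) : ℤ := ordDet L.exists_ofBasis.choose

theorem deg_anti {L M : OLattice} (h : L ≤ M) : M.deg ≤ L.deg := by
  apply ordDet_le
  rw [L.exists_ofBasis.choose_spec, M.exists_ofBasis.choose_spec]
  exact h

theorem eq_of_le_of_deg_le {L M : OLattice} (h : L ≤ M) (hd : L.deg ≤ M.deg) : L = M := by
  refine le_antisymm h ?_
  have hd' : L.deg = M.deg := le_antisymm hd (deg_anti h)
  rw [le_def]
  have := ofBasis_le_of_ordDet_eq (v := L.exists_ofBasis.choose) (w := M.exists_ofBasis.choose)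
  rw [L.exists_ofBasis.choose_spec, M.exists_ofBasis.choose_spec] at this
  exact this h hd'

theorem deg_lt {L M : OLattice} (h : L < M) : M.deg < L.deg := by
  by_contra hd
  exact h.ne (eq_of_le_of_deg_le h.le (not_lt.1 hd))

theorem deg_ofBasis (v : Basis (Fin 3) K U) : (ofBasis v).deg = ordDet v :=
  le_antisymm (ordDet_le ((ofBasis v).exists_ofBasis.choose_spec.ge))
    (ordDet_le ((ofBasis v).exists_ofBasis.choose_spec.le))

theorem ofBasis_unitsSMul_const (v : Basis (Fin 3) K U) (k : ℤ) :
    ofBasis (v.unitsSMul fun _ => t ^ k) = (ofBasis v).scale k := by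
  ext1
  ext x
  rw [mem_scale, mem_ofBasis, mem_ofBasis]
  refine forall_congr' fun i => ?_
  rw [Basis.repr_unitsSMul, ← zpow_neg]
  simp [Units.smul_def]

theorem deg_scale (k : ℤ) (L : OLattice) : (L.scale k).deg = L.deg + 3 * k := by
  obtain ⟨v, hv⟩ := L.exists_ofBasis
  obtain rfl : ofBasis v = L := ext hv
  rw [← ofBasis_unitsSMul_const, deg_ofBasis, deg_ofBasis, ordDet_unitsSMul]
  simp

/-! ### The exponent of one lattice in another -/

theorem bddBelow_scale_le (L M : OLattice) : BddBelow {m : ℤ | M.scale m ≤ L} := by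
  refine ⟨(L.deg - M.deg) / 3, fun m hm => ?_⟩
  have := deg_anti hm
  rw [deg_scale] at this
  omega

/-- The least `m` with `t ^ m M ⊆ L`. -/
noncomputable def expo (L M : OLattice) : ℤ := sInf {m : ℤ | M.scale m ≤ L}

theorem expo_le_iff {L M : OLattice} {m : ℤ} : expo L M ≤ m ↔ M.scale m ≤ L := by
  constructor
  · intro h
    have h1 : M.scale (expo L M) ≤ L := Int.csInf_mem (exists_scale_le L M) (bddBelow_scale_le L M)
    refine le_trans ?_ h1
    have h2 := scale_mono (expo L M) (scale_le_self_iff (L := M).2 (sub_nonneg.2 h))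
    rwa [scale_scale, add_sub_cancel] at h2
  · intro h
    exact csInf_le (bddBelow_scale_le L M) h

theorem expo_scale_scale (k l : ℤ) (L M : OLattice) :
    expo (L.scale k) (M.scale l) = expo L M + k - l := by
  refine eq_of_forall_ge_iff fun m => ?_
  rw [expo_le_iff, scale_scale, show expo L M + k - l ≤ m ↔ expo L M ≤ m + l - k by omega,
    expo_le_iff, ← scale_le_scale_iff k (M := L), scale_scale]
  ring_nf

end OLattice

open OLattice

/-! ### The directed distance -/

theorem cls_scale (k : ℤ) (L : OLattice) : cls (L.scale k) = cls L :=
  (Quotient.sound ⟨k, rfl⟩ : cls L = cls (L.scale k)).symm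

theorem cls_eq_iff {L M : OLattice} : cls L = cls M ↔ ∃ k : ℤ, M = L.scale k := by
  constructor
  · intro h
    obtain ⟨k, hk⟩ := Quotient.exact h
    exact ⟨k, OLattice.ext hk⟩
  · rintro ⟨k, rfl⟩
    exact (cls_scale k L).symm

theorem exists_cls (x : Vertex) : ∃ L, cls L = x := Quotient.exists_rep x

/-- The directed distance between two vertices of the building: the colength in `L`, where
`x = [L]`, of the largest representative of `y` inside `L`. It is the length of a shortest path from
`x` to `y`, where a step from `[L]` to `[M]` with `t L ⊂ M ⊂ L` has length `dim L / M`. -/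
noncomputable def F (x y : Vertex) : ℤ :=
  Quotient.liftOn₂ x y (fun L M => 3 * expo L M + M.deg - L.deg) (by
    rintro L M L' M' ⟨k, hk⟩ ⟨l, hl⟩
    obtain rfl : L' = L.scale k := OLattice.ext hk
    obtain rfl : M' = M.scale l := OLattice.ext hl
    simp only [expo_scale_scale, deg_scale]
    ring)

theorem F_cls (L M : OLattice) : F (cls L) (cls M) = 3 * expo L M + M.deg - L.deg := rfl

/-- The directed distance detects inclusions of lattices. -/
theorem F_le_iff {L M : OLattice} : F (cls L) (cls M) ≤ M.deg - L.deg ↔ M ≤ L := by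
  rw [F_cls, show 3 * expo L M + M.deg - L.deg ≤ M.deg - L.deg ↔ expo L M ≤ 0 by omega,
    expo_le_iff, scale_zero]

theorem F_emod (L M : OLattice) : F (cls L) (cls M) % 3 = (M.deg - L.deg) % 3 := by
  rw [F_cls]; omega

/-- A representative of `y` that is as large as possible inside `L`. -/
theorem exists_le_rep (L : OLattice) (y : Vertex) :
    ∃ M, cls M = y ∧ M ≤ L ∧ F (cls L) y = M.deg - L.deg := by
  obtain ⟨M, rfl⟩ := exists_cls y
  refine ⟨M.scale (expo L M), cls_scale _ _, expo_le_iff.1 le_rfl, ?_⟩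
  rw [F_cls, deg_scale]; ring

/-- A representative of `x` that is as small as possible among those containing `M`. -/
theorem exists_ge_rep (M : OLattice) (x : Vertex) :
    ∃ L, cls L = x ∧ M ≤ L ∧ F x (cls M) = M.deg - L.deg := by
  obtain ⟨L, rfl⟩ := exists_cls x
  have h : F (cls L) (cls M) = M.deg - (L.scale (-expo L M)).deg := by
    rw [F_cls, deg_scale]; ring
  refine ⟨L.scale (-expo L M), cls_scale _ _, ?_, h⟩
  rw [← F_le_iff, cls_scale, h]

theorem F_nonneg (x y : Vertex) : 0 ≤ F x y := by
  obtain ⟨L, rfl⟩ := exists_cls x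
  obtain ⟨M, rfl, h, h1⟩ := exists_le_rep L y
  have := deg_anti h
  omega

theorem F_eq_zero_iff {x y : Vertex} : F x y = 0 ↔ x = y := by
  obtain ⟨L, rfl⟩ := exists_cls x
  obtain ⟨M, rfl, h, h1⟩ := exists_le_rep L y
  constructor
  · intro h0
    rw [eq_of_le_of_deg_le h (by omega)]
  · intro h0
    have h2 : F (cls L) (cls L) ≤ 0 := by simpa using (F_le_iff (L := L) (M := L)).2 le_rfl
    rw [← h0]
    exact le_antisymm h2 (F_nonneg _ _)

@[simp] theorem F_self (x : Vertex) : F x x = 0 := F_eq_zero_iff.2 rfl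

theorem F_triangle (x y z : Vertex) : F x z ≤ F x y + F y z := by
  obtain ⟨L, rfl⟩ := exists_cls x
  obtain ⟨M, rfl, h, h1⟩ := exists_le_rep L y
  obtain ⟨N, rfl, h', h1'⟩ := exists_le_rep M z
  have := F_le_iff.2 (h'.trans h)
  omega

/-- Modulo `3` the directed distance is the difference of the types of the two vertices. -/
theorem F_cocycle (x y z : Vertex) : (F x y + F y z) % 3 = F x z % 3 := by
  obtain ⟨L, rfl⟩ := exists_cls x
  obtain ⟨M, rfl⟩ := exists_cls y
  obtain ⟨N, rfl⟩ := exists_cls z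
  rw [F_cls, F_cls, F_cls]; omega

/-! ### Distances in a common basis -/

namespace OLattice

theorem scale_one_carrier (L : OLattice) : (L.scale 1).carrier = t • L.carrier := by
  show t ^ (1 : ℤ) • _ = _
  rw [zpow_one]

theorem scale_ofBasis_unitsSMul (v : Basis (Fin 3) K U) (k : Fin 3 → ℤ) (m : ℤ) :
    (ofBasis (v.unitsSMul fun i => t ^ k i)).scale m =
      ofBasis (v.unitsSMul fun i => t ^ (m + k i)) := by
  rw [← ofBasis_unitsSMul_const]
  refine congrArg ofBasis (Basis.eq_of_apply_eq fun i => ?_)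
  rw [Basis.unitsSMul_apply, Basis.unitsSMul_apply, Basis.unitsSMul_apply, smul_smul, zpow_add]

theorem ofBasis_unitsSMul_le_iff (v : Basis (Fin 3) K U) (k l : Fin 3 → ℤ) :
    ofBasis (v.unitsSMul fun i => t ^ k i) ≤ ofBasis (v.unitsSMul fun i => t ^ l i) ↔
      ∀ i, l i ≤ k i := by
  have key : ∀ i j, (v.unitsSMul fun i => t ^ l i).repr ((v.unitsSMul fun i => t ^ k i) j) i =
      if j = i then ((t ^ (k i - l i) : Kˣ) : K) else 0 := by
    intro i j
    rw [Basis.repr_unitsSMul, Basis.unitsSMul_apply, Units.smul_def, Units.smul_def, map_smul,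
      Basis.repr_self, Finsupp.smul_apply, Finsupp.single_apply]
    split_ifs with h
    · subst h
      rw [smul_eq_mul, smul_eq_mul, mul_one, sub_eq_neg_add, zpow_add, Units.val_mul, zpow_neg]
    · simp
  constructor
  · intro h i
    have h1 := (mem_ofBasis _ _).1 (h (Submodule.subset_span ⟨i, rfl⟩)) i
    rw [key, if_pos rfl, t_zpow_mem_integers_iff] at h1
    omega
  · intro h
    refine Submodule.span_le.2 ?_
    rintro _ ⟨j, rfl⟩
    refine (mem_ofBasis _ _).2 fun i => ?_
    rw [key]
    split_ifs
    · rw [t_zpow_mem_integers_iff]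
      have := h i
      omega
    · exact zero_mem _

end OLattice

theorem F_of_hasDist {x y : Vertex} {μ : Fin 3 → ℤ} (h : HasDist x y μ) :
    F x y = 2 * μ 0 - μ 1 - μ 2 ∧ F y x = μ 0 + μ 1 - 2 * μ 2 := by
  obtain ⟨hμ, v, rfl, rfl⟩ := h
  have h01 : μ 1 ≤ μ 0 := hμ (by decide)
  have h12 : μ 2 ≤ μ 1 := hμ (by decide)
  have hv : ofBasis v = ofBasis (v.unitsSMul fun i => t ^ ((fun _ => 0 : Fin 3 → ℤ) i)) := by
    refine congrArg ofBasis (Basis.eq_of_apply_eq fun i => ?_)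
    rw [Basis.unitsSMul_apply, zpow_zero, one_smul]
  have e1 : expo (ofBasis v) (ofBasis (v.unitsSMul fun i => t ^ (-μ i))) = μ 0 := by
    refine eq_of_forall_ge_iff fun m => ?_
    rw [expo_le_iff, hv, scale_ofBasis_unitsSMul v (fun i => -μ i),
      ofBasis_unitsSMul_le_iff v (fun i => m + -μ i), Fin.forall_fin_succ, Fin.forall_fin_two]
    simp only [Fin.succ_zero_eq_one, Fin.succ_one_eq_two]
    omega
  have e2 : expo (ofBasis (v.unitsSMul fun i => t ^ (-μ i))) (ofBasis v) = -μ 2 := by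
    refine eq_of_forall_ge_iff fun m => ?_
    rw [expo_le_iff, hv, scale_ofBasis_unitsSMul v (fun _ => 0),
      ofBasis_unitsSMul_le_iff v _ (fun i => -μ i), Fin.forall_fin_succ, Fin.forall_fin_two]
    simp only [Fin.succ_zero_eq_one, Fin.succ_one_eq_two]
    omega
  rw [F_cls, F_cls, e1, e2, deg_ofBasis, deg_ofBasis, ordDet_unitsSMul v (fun i => -μ i),
    Fin.sum_univ_three]
  constructor <;> ring

/-! ### Adjacency -/

theorem adj_iff {x y : Vertex} : Adj x y ↔ F x y + F y x = 3 := by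
  constructor
  · rintro ⟨L, M, rfl, rfl, h1, h2⟩
    have h1' : L.scale 1 < M := by
      rw [OLattice.lt_def, scale_one_carrier]; exact h1
    have h2' : M < L := h2
    have a1 := F_le_iff.2 h2'.le
    have a2 := F_le_iff.2 h1'.le
    have a3 := deg_lt h1'
    have a4 := deg_lt h2'
    have a5 := F_emod L M
    have a6 := F_nonneg (cls L) (cls M)
    have a7 := F_nonneg (cls M) (cls L)
    have a8 := F_emod M L
    rw [cls_scale, deg_scale] at a2
    rw [deg_scale] at a3
    omega
  · intro h
    obtain ⟨L, rfl⟩ := exists_cls x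
    obtain ⟨M, rfl, h1, h2⟩ := exists_le_rep L y
    have a1 : L.scale 1 ≤ M := by
      rw [← F_le_iff, cls_scale, deg_scale]; omega
    have hne : cls L ≠ cls M := by
      intro he
      rw [he] at h
      simp at h
    refine ⟨L, M, rfl, rfl, ?_, ?_⟩
    · have : L.scale 1 < M := lt_of_le_of_ne a1 (by
        rintro rfl
        exact hne (cls_scale _ _).symm)
      rw [OLattice.lt_def, scale_one_carrier] at this
      exact this
    · exact lt_of_le_of_ne (le_def.1 h1) fun he => hne (by rw [OLattice.ext he])

/-- `Step x y`: the vertices are adjacent, with representatives `t L ⊂ M ⊂ L` such that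
`dim L / M = 1`. -/
def Step (x y : Vertex) : Prop := F x y = 1 ∧ F y x = 2

theorem adj_iff_step {x y : Vertex} : Adj x y ↔ Step x y ∨ Step y x := by
  rw [adj_iff, Step, Step]
  have h1 := F_nonneg x y
  have h2 := F_nonneg y x
  constructor
  · intro h
    have h3 : F x y ≠ 0 := by
      intro h0
      rw [F_eq_zero_iff] at h0
      subst h0
      simp at h
    have h4 : F y x ≠ 0 := by
      intro h0
      rw [F_eq_zero_iff] at h0
      subst h0
      simp at h
    omega
  · omega

theorem Step.adj {x y : Vertex} (h : Step x y) : Adj x y := adj_iff_step.2 (Or.inl h)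

theorem Adj.symm {x y : Vertex} (h : Adj x y) : Adj y x := by
  rw [adj_iff] at *; omega

theorem Adj.ne {x y : Vertex} (h : Adj x y) : x ≠ y := by
  rintro rfl
  rw [adj_iff] at h
  simp at h

theorem Step.of_hasDist_omega1 {x y : Vertex} (h : HasDist x y omega1) : Step y x := by
  have := F_of_hasDist h
  simpa [omega1, Step, and_comm] using this

theorem Step.of_hasDist_omega2 {x y : Vertex} (h : HasDist x y omega2) : Step x y := by
  have := F_of_hasDist h
  simpa [omega2, Step, and_comm] using this

theorem Step.exists_le {L : OLattice} {y : Vertex} (h : Step (cls L) y) :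
    ∃ M, cls M = y ∧ M ≤ L ∧ L.scale 1 ≤ M ∧ M.deg = L.deg + 1 := by
  obtain ⟨M, rfl, h1, h2⟩ := exists_le_rep L y
  refine ⟨M, rfl, h1, ?_, ?_⟩
  · rw [← F_le_iff, cls_scale, deg_scale]
    have := h.1
    have := h.2
    omega
  · have := h.1
    omega

theorem Step.exists_le' {L : OLattice} {y : Vertex} (h : Step y (cls L)) :
    ∃ M, cls M = y ∧ M ≤ L ∧ L.scale 1 ≤ M ∧ M.deg = L.deg + 2 := by
  obtain ⟨M, rfl, h1, h2⟩ := exists_le_rep L y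
  refine ⟨M, rfl, h1, ?_, ?_⟩
  · rw [← F_le_iff, cls_scale, deg_scale]
    have := h.1
    have := h.2
    omega
  · have := h.2
    omega

theorem Step.of_le {L M : OLattice} (h1 : M ≤ L) (h2 : L.scale 1 ≤ M) (h3 : M.deg = L.deg + 1) :
    Step (cls L) (cls M) := by
  have a1 := F_le_iff.2 h1
  have a2 := F_le_iff.2 h2
  have a3 := F_emod L M
  have a4 := F_emod M L
  have a5 := F_nonneg (cls L) (cls M)
  have a6 := F_nonneg (cls M) (cls L)
  rw [cls_scale, deg_scale] at a2
  constructor <;> omega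

theorem Step.of_le' {L M : OLattice} (h1 : M ≤ L) (h2 : L.scale 1 ≤ M) (h3 : M.deg = L.deg + 2) :
    Step (cls M) (cls L) := by
  have a1 := F_le_iff.2 h1
  have a2 := F_le_iff.2 h2
  have a3 := F_emod L M
  have a4 := F_emod M L
  have a5 := F_nonneg (cls L) (cls M)
  have a6 := F_nonneg (cls M) (cls L)
  rw [cls_scale, deg_scale] at a2
  constructor <;> omega

/-- A sublattice of colength one is spanned by a basis of the large lattice, with one basis vector
multiplied by `t`. -/
theorem Step.hasDist {x y : Vertex} (h : Step y x) : HasDist x y omega1 := by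
  refine ⟨by decide, ?_⟩
  obtain ⟨Y, rfl⟩ := exists_cls y
  obtain ⟨X, rfl, hXY, htY, hdeg⟩ := h.exists_le
  obtain ⟨u₀, hu₀⟩ := Y.exists_ofBasis
  obtain ⟨u, hu, hu0⟩ : ∃ u : Basis (Fin 3) K U, (ofBasis u).carrier = Y.carrier ∧
      u 0 ∉ X.carrier := by
    obtain ⟨i, hi⟩ : ∃ i, u₀ i ∉ X.carrier := by
      by_contra! hcon
      have h1 : Y ≤ X := by
        rw [le_def, ← hu₀]
        exact Submodule.span_le.2 (by rintro _ ⟨i, rfl⟩; exact hcon i)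
      have := deg_anti h1
      omega
    refine ⟨u₀.reindex (Equiv.swap 0 i), ?_, by simpa using hi⟩
    rw [← hu₀]
    show Submodule.span O _ = Submodule.span O _
    rw [Basis.range_reindex]
  have huY : ∀ j, u j ∈ Y.carrier := fun j => by
    rw [← hu]; exact Submodule.subset_span ⟨j, rfl⟩
  have hX' : X.carrier ⊔ Submodule.span O {u 0} = Y.carrier := by
    have := X.isLattice
    let X' : OLattice := ⟨X.carrier ⊔ Submodule.span O {u 0},
      Submodule.IsLattice.of_le_of_isLattice_of_fg K (M := X.carrier) le_sup_left
        (Submodule.FG.sup Submodule.IsLattice.fg (Submodule.fg_span_singleton _))⟩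
    have h1 : X < X' := by
      refine lt_of_le_of_ne (le_def.2 le_sup_left) fun he => hu0 ?_
      rw [he]
      exact (le_sup_right : Submodule.span O {u 0} ≤ _) (Submodule.mem_span_singleton_self _)
    have h2 : X' ≤ Y := by
      rw [le_def]
      refine sup_le hXY (Submodule.span_le.2 ?_)
      rintro _ rfl
      exact huY 0
    have h3 := deg_lt h1
    exact congrArg carrier (eq_of_le_of_deg_le h2 (by omega))
  have hc : ∀ j, ∃ c : O, u j - c • u 0 ∈ X.carrier := by
    intro j
    have := huY j
    rw [← hX', Submodule.mem_sup] at this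
    obtain ⟨a, ha, b, hb, hab⟩ := this
    obtain ⟨c, rfl⟩ := Submodule.mem_span_singleton.1 hb
    exact ⟨c, by rwa [← hab, add_sub_cancel_right]⟩
  choose c hc using hc
  let w : Fin 3 → U := fun j => if j = 0 then u 0 else u j - c j • u 0
  have hw0 : w 0 = u 0 := if_pos rfl
  have hwj : ∀ j, j ≠ 0 → w j = u j - c j • u 0 := fun j hj => if_neg hj
  have hspan : ⊤ ≤ Submodule.span K (Set.range w) := by
    rw [← u.span_eq]
    refine Submodule.span_le.2 ?_
    rintro _ ⟨j, rfl⟩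
    have h0 : u 0 ∈ Submodule.span K (Set.range w) := Submodule.subset_span ⟨0, hw0⟩
    by_cases hj : j = 0
    · rw [hj]; exact h0
    · have h1 : w j ∈ Submodule.span K (Set.range w) := Submodule.subset_span ⟨j, rfl⟩
      have h2 := add_mem h1 (Submodule.smul_mem _ (algebraMap O K (c j)) h0)
      rwa [← smul_eq_algebraMap_smul, hwj j hj, sub_add_cancel] at h2
  let wb : Basis (Fin 3) K U := Basis.mk
    (linearIndependent_of_top_le_span_of_card_eq_finrank hspan (by simp)) hspan
  have hwb : ∀ j, wb j = w j := fun j => by simp [wb]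
  have hwY : ofBasis wb = Y := by
    ext1
    refine le_antisymm (Submodule.span_le.2 ?_) ?_
    · rintro _ ⟨j, rfl⟩
      rw [hwb]
      by_cases hj : j = 0
      · rw [hj, hw0]; exact huY 0
      · rw [hwj j hj]
        exact sub_mem (huY j) (Y.carrier.smul_mem _ (huY 0))
    · rw [← hu]
      refine Submodule.span_le.2 ?_
      rintro _ ⟨j, rfl⟩
      have h0 : u 0 ∈ (ofBasis wb).carrier :=
        Submodule.subset_span ⟨0, by rw [hwb, hw0]⟩
      by_cases hj : j = 0
      · rw [hj]; exact h0
      · have h1 : wb j ∈ (ofBasis wb).carrier := Submodule.subset_span ⟨j, rfl⟩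
        have h2 := add_mem h1 ((ofBasis wb).carrier.smul_mem (c j) h0)
        rwa [hwb, hwj j hj, sub_add_cancel] at h2
  refine ⟨wb.unitsSMul fun i => t ^ omega1 i, ?_, ?_⟩
  · have h1 : ofBasis (wb.unitsSMul fun i => t ^ omega1 i) = X := by
      refine eq_of_le_of_deg_le ?_ ?_
      · rw [le_def]
        refine Submodule.span_le.2 ?_
        rintro _ ⟨j, rfl⟩
        rw [Basis.unitsSMul_apply]
        by_cases hj : j = 0
        · subst hj
          apply htY
          rw [mem_scale, Units.smul_def, smul_smul, ← Units.val_mul, ← zpow_add, hwb, hw0]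
          simpa [omega1] using huY 0
        · have : omega1 j = 0 := by fin_cases j <;> simp_all [omega1]
          rw [this, hwb, hwj j hj, zpow_zero, one_smul]
          exact hc j
      · rw [deg_ofBasis, ordDet_unitsSMul, ← deg_ofBasis, hwY, hdeg, Fin.sum_univ_three]
        simp [omega1]
    rw [h1]
  · have h1 : ((wb.unitsSMul fun i => t ^ omega1 i).unitsSMul fun i => t ^ (-omega1 i)) = wb := by
      ext1 j
      rw [Basis.unitsSMul_apply, Basis.unitsSMul_apply, smul_smul, ← zpow_add]
      simp
    rw [h1, hwY]

theorem hasDist_omega1_iff {x y : Vertex} : HasDist x y omega1 ↔ Step y x :=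
  ⟨Step.of_hasDist_omega1, Step.hasDist⟩

/-! ### Edges of the building seen from a distance -/

namespace OLattice

theorem inter_le_left (L M : OLattice) : L.inter M ≤ L := le_def.2 inf_le_left
theorem inter_le_right (L M : OLattice) : L.inter M ≤ M := le_def.2 inf_le_right
theorem le_inter {L M N : OLattice} (h : N ≤ L) (h' : N ≤ M) : N ≤ L.inter M :=
  le_def.2 (le_inf h h')
theorem le_sum_left (L M : OLattice) : L ≤ L.sum M := le_def.2 le_sup_left
theorem le_sum_right (L M : OLattice) : M ≤ L.sum M := le_def.2 le_sup_right
theorem sum_le {L M N : OLattice} (h : L ≤ N) (h' : M ≤ N) : L.sum M ≤ N :=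
  le_def.2 (sup_le h h')

/-- A sublattice `M` of colength one in `L` is the intersection of `L` with any lattice that
contains `M` and not `L`. -/
theorem eq_inter {L M A : OLattice} (h1 : M ≤ L) (h2 : M ≤ A) (h3 : ¬ L ≤ A)
    (hd : M.deg = L.deg + 1) : M = L.inter A := by
  refine eq_of_le_of_deg_le (le_inter h1 h2) ?_
  have : L.inter A < L := lt_of_le_of_ne (inter_le_left _ _) fun he =>
    h3 (he ▸ inter_le_right L A)
  have := deg_lt this
  omega

/-- An overlattice `M` of `L` with `L` of colength one in `M` is the sum of `L` and any lattice
contained in `M` and not in `L`. -/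
theorem eq_sum {L M B : OLattice} (h1 : L ≤ M) (h2 : B ≤ M) (h3 : ¬ B ≤ L)
    (hd : L.deg = M.deg + 1) : M = L.sum B := by
  refine (eq_of_le_of_deg_le (sum_le h1 h2) ?_).symm
  have : L < L.sum B := lt_of_le_of_ne (le_sum_left _ _) fun he =>
    h3 (he ▸ le_sum_right L B)
  have := deg_lt this
  omega

/-- A lattice lying between two homothetic lattices without being homothetic to them separates
them strictly. -/
theorem le_scale_one {A B L : OLattice} (hBL : B ≤ L) (hLA : L ≤ A) (hAB : cls A = cls B)
    (hne : cls L ≠ cls A) : B ≤ A.scale 1 := by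
  obtain ⟨k, rfl⟩ := cls_eq_iff.1 hAB
  have hk : 0 ≤ k := scale_le_self_iff.1 (hBL.trans hLA)
  rcases eq_or_lt_of_le hk with rfl | hk
  · rw [scale_zero] at hBL
    exact absurd (by rw [le_antisymm hBL hLA]) hne
  · have := scale_mono 1 (scale_le_self_iff (L := A).2 (show 0 ≤ k - 1 by omega))
    rwa [scale_scale, add_sub_cancel] at this

end OLattice

/-- If the step from `x` to `y` brings one closer to `a` and leads away from `b`, then `x` lies on a
shortest path from `a` to `b`. -/
theorem Step.F_eq_add {x y a b : Vertex} (h : Step x y) (ha : F a y < F a x)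
    (hb : F x b < F y b) : F a b = F a x + F x b := by
  refine le_antisymm (F_triangle _ _ _) ?_
  obtain ⟨L, rfl⟩ := exists_cls x
  obtain ⟨M, rfl, hML, -, hd⟩ := h.exists_le
  obtain ⟨A, rfl, hMA, hA⟩ := exists_ge_rep M a
  obtain ⟨B, rfl, hBL, hB⟩ := exists_le_rep L b
  have hLA : ¬ L ≤ A := by rw [← F_le_iff]; omega
  have hBM : ¬ B ≤ M := by rw [← F_le_iff]; omega
  have hBA : ¬ B ≤ A := fun hBA => hBM (by
    rw [eq_inter hML hMA hLA hd]; exact le_inter hBL hBA)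
  rw [← F_le_iff] at hBA
  have e1 := F_emod A B
  have e2 : F (cls A) (cls L) ≤ F (cls A) (cls M) + F (cls M) (cls L) := F_triangle _ _ _
  have := h.2
  omega

theorem Step.F_left_cases {x y : Vertex} (h : Step x y) (a : Vertex) :
    F a y = F a x + 1 ∨ F a y = F a x - 2 := by
  have h1 := F_triangle a x y
  have h2 := F_triangle a y x
  have h3 := F_cocycle a x y
  have := h.1
  have := h.2
  omega

theorem Step.F_right_cases {x y : Vertex} (h : Step x y) (b : Vertex) :
    F y b = F x b - 1 ∨ F y b = F x b + 2 := by
  have h1 := F_triangle x y b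
  have h2 := F_triangle y x b
  have h3 := F_cocycle x y b
  have := h.1
  have := h.2
  omega

/-- The triangle on the side of the edge `x`, `y` on which `c` lies, for a vertex `c` in the
directions off this edge. Its third vertex is the sum of lattices `t L + B` and the intersection
`M ∩ A`, where `L`, `M` represent `x`, `y` and `A`, `B` represent `c`. -/
theorem Step.exists_third {x y c : Vertex} (h : Step x y) (h1 : F c x < F c y)
    (h2 : F y c < F x c) :
    ∃ z, Step y z ∧ Step z x ∧ F c z < F c y ∧ F z c < F y c ∧
      (∀ X, MinConvex X → y ∈ X → c ∈ X → z ∈ X) ∧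
      (∀ X, MaxConvex X → x ∈ X → c ∈ X → z ∈ X) := by
  obtain ⟨L, rfl⟩ := exists_cls x
  obtain ⟨M, rfl, hML, hLM, hd⟩ := h.exists_le
  obtain ⟨A₀, rfl, hLA, hA⟩ := exists_ge_rep L c
  obtain ⟨B, hBc, hBL, hB⟩ := exists_le_rep L (cls A₀)
  have d1 := h.F_left_cases (cls A₀)
  have d2 := h.F_right_cases (cls A₀)
  set A := A₀.scale 1 with hAdef
  have hAc : cls A = cls A₀ := cls_scale _ _
  have hAdeg : A.deg = A₀.deg + 3 := by rw [hAdef, deg_scale]; ring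
  have hLdeg : (L.scale 1).deg = L.deg + 3 := by rw [deg_scale]; ring
  have hMA : ¬ M ≤ A := by rw [← F_le_iff, hAc]; omega
  have hLA' : L.scale 1 ≤ A := scale_mono 1 hLA
  have hBM : B ≤ M := by rw [← F_le_iff, hBc]; omega
  have hBtL : ¬ B ≤ L.scale 1 := by rw [← F_le_iff, hBc, cls_scale]; omega
  have hBA : B ≤ A := by
    refine le_scale_one hBL hLA hBc.symm fun he => ?_
    rw [he] at h2
    have := F_nonneg (cls M) (cls A₀)
    simp at h2
    omega
  set N := (L.scale 1).sum B with hN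
  have hNM : N ≤ M := sum_le hLM hBM
  have hNA : N ≤ A := sum_le hLA' hBA
  have hMN : ¬ M ≤ N := fun h' => hMA (h'.trans hNA)
  have hNd : N.deg = L.deg + 2 := by
    have a1 : N < M := lt_of_le_not_ge hNM hMN
    have a2 : L.scale 1 < N := lt_of_le_not_ge (le_sum_left _ _) fun h' =>
      hBtL ((le_sum_right _ _).trans h')
    have := deg_lt a1
    have := deg_lt a2
    omega
  have hNint : N = M.inter A := eq_inter hNM hNA hMA (by omega)
  refine ⟨cls N, ?_, ?_, ?_, ?_, ?_, ?_⟩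
  · refine Step.of_le hNM ((scale_mono 1 hML).trans (le_sum_left _ _)) (by omega)
  · exact Step.of_le' (hNM.trans hML) (le_sum_left _ _) (by omega)
  · have := F_le_iff.2 hNA
    rw [hAc] at this
    omega
  · have hBN : B ≤ N := le_sum_right _ _
    have := F_le_iff.2 hBN
    rw [hBc] at this
    omega
  · intro X hX hy hc
    rw [hNint]
    exact hX M A hy (hAc ▸ hc)
  · intro X hX hx hc
    exact hX (L.scale 1) B (by rwa [cls_scale]) (hBc ▸ hc)

/-- The third vertex in `Step.exists_third` is unique. -/
theorem Step.third_unique {x y z z' c : Vertex} (h : Step x y) (h2 : F y c < F x c)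
    (hz : Step z x) (hyz : Step y z) (hc : F z c < F y c)
    (hz' : Step z' x) (hyz' : Step y z') (hc' : F z' c < F y c) : z = z' := by
  obtain ⟨L, rfl⟩ := exists_cls x
  obtain ⟨N, rfl, hNL, hLN, hd⟩ := hz.exists_le'
  obtain ⟨N', rfl, hNL', hLN', hd'⟩ := hz'.exists_le'
  obtain ⟨B, rfl, hBL, hB⟩ := exists_le_rep L c
  have d2 := h.F_right_cases (cls B)
  have d3 := hyz.F_right_cases (cls B)
  have d3' := hyz'.F_right_cases (cls B)
  have hBN : B ≤ N := by rw [← F_le_iff]; omega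
  have hBN' : B ≤ N' := by rw [← F_le_iff]; omega
  have hLdeg : (L.scale 1).deg = L.deg + 3 := by rw [deg_scale]; ring
  have hBtL : ¬ B ≤ L.scale 1 := by rw [← F_le_iff, cls_scale]; omega
  rw [eq_sum hLN hBN hBtL (by omega), eq_sum hLN' hBN' hBtL (by omega)]

/-- Two different steps `v → w`, `v → w'` have at most one common completion to a triangle. -/
theorem Step.third_unique_of_ne {v w w' z z' : Vertex} (h : Step v w) (h' : Step v w')
    (hne : w ≠ w') (hz : Step w z) (hz' : Step w' z) (hzv : Step z v)
    (hy : Step w z') (hy' : Step w' z') (hyv : Step z' v) : z = z' := by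
  obtain ⟨L, rfl⟩ := exists_cls v
  obtain ⟨M, rfl, hML, -, hM⟩ := h.exists_le
  obtain ⟨M', rfl, hML', -, hM'⟩ := h'.exists_le
  have key : ∀ z, Step (cls M) z → Step (cls M') z → Step z (cls L) →
      z = cls (M.inter M') := by
    intro z hz hz' hzv
    obtain ⟨N, rfl, -, -, hN⟩ := hzv.exists_le'
    have a1 : N ≤ M := by
      rw [← F_le_iff]
      have := hz.1
      omega
    have a2 : N ≤ M' := by
      rw [← F_le_iff]
      have := hz'.1
      omega
    have a3 : ¬ M ≤ M' := fun hle => hne (by rw [eq_of_le_of_deg_le hle (by omega)])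
    rw [eq_inter a1 a2 a3 (by omega)]
  rw [key z hz hz' hzv, key z' hy hy' hyv]

/-! ### Convex hulls -/

theorem subset_minconv (S : Set Vertex) : S ⊆ minconv S := fun _ hx _ hX => hX.2 hx
theorem subset_maxconv (S : Set Vertex) : S ⊆ maxconv S := fun _ hx _ hX => hX.2 hx
theorem subset_conv (S : Set Vertex) : S ⊆ conv S := fun _ hx =>
  ⟨subset_minconv S hx, subset_maxconv S hx⟩

theorem minConvex_minconv (S : Set Vertex) : MinConvex (minconv S) := fun L M hL hM X hX =>
  hX.1 L M (hL X hX) (hM X hX)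
theorem maxConvex_maxconv (S : Set Vertex) : MaxConvex (maxconv S) := fun L M hL hM X hX =>
  hX.1 L M (hL X hX) (hM X hX)

/-- A lattice in the min-convex hull of `S` is the intersection of the lattices over it with class
in `S`. -/
theorem le_of_mem_minconv {S : Set Vertex} {M : OLattice} (hM : cls M ∈ minconv S) {L : OLattice}
    (h : ∀ A, cls A ∈ S → M ≤ A → L ≤ A) : L ≤ M := by
  let X : Set Vertex := {x | ∀ M, cls M = x → ∀ L : OLattice,
    (∀ A, cls A ∈ S → M ≤ A → L ≤ A) → L ≤ M}
  have hX : MinConvex X ∧ S ⊆ X := by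
    constructor
    · intro M₁ M₂ h1 h2 M hM L hL
      obtain ⟨k, rfl⟩ := cls_eq_iff.1 hM.symm
      have e : (M₁.inter M₂).scale k = (M₁.scale k).inter (M₂.scale k) := by
        refine le_antisymm (le_inter (scale_mono k (inter_le_left _ _))
          (scale_mono k (inter_le_right _ _))) ?_
        intro x hx
        rw [mem_scale]
        exact ⟨mem_scale.1 hx.1, mem_scale.1 hx.2⟩
      rw [e] at hL ⊢
      exact le_inter
        (h1 _ (cls_scale k M₁) L fun A hA hle => hL A hA ((inter_le_left _ _).trans hle))
        (h2 _ (cls_scale k M₂) L fun A hA hle => hL A hA ((inter_le_right _ _).trans hle))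
    · rintro x hx M rfl L hL
      exact hL M hx le_rfl
  exact hM X hX M rfl L h

/-- A lattice in the max-convex hull of `S` is the sum of the lattices in it with class in `S`. -/
theorem le_of_mem_maxconv {S : Set Vertex} {M : OLattice} (hM : cls M ∈ maxconv S) {L : OLattice}
    (h : ∀ A, cls A ∈ S → A ≤ M → A ≤ L) : M ≤ L := by
  let X : Set Vertex := {x | ∀ M, cls M = x → ∀ L : OLattice,
    (∀ A, cls A ∈ S → A ≤ M → A ≤ L) → M ≤ L}
  have hX : MaxConvex X ∧ S ⊆ X := by
    constructor
    · intro M₁ M₂ h1 h2 M hM L hL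
      obtain ⟨k, rfl⟩ := cls_eq_iff.1 hM.symm
      have e : (M₁.sum M₂).scale k ≤ (M₁.scale k).sum (M₂.scale k) := by
        rw [← scale_le_scale_iff (-k), scale_scale, neg_add_cancel, scale_zero]
        refine sum_le ?_ ?_
        · have := scale_mono (-k) (le_sum_left (M₁.scale k) (M₂.scale k))
          rwa [scale_scale, neg_add_cancel, scale_zero] at this
        · have := scale_mono (-k) (le_sum_right (M₁.scale k) (M₂.scale k))
          rwa [scale_scale, neg_add_cancel, scale_zero] at this
      refine e.trans (sum_le ?_ ?_)
      · exact h1 _ (cls_scale k M₁) L fun A hA hle =>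
          hL A hA (hle.trans (scale_mono k (le_sum_left _ _)))
      · exact h2 _ (cls_scale k M₂) L fun A hA hle =>
          hL A hA (hle.trans (scale_mono k (le_sum_right _ _)))
    · rintro x hx M rfl L hL
      exact hL M hx le_rfl
  exact hM X hX M rfl L h

/-- The vertices of `S` do not all lie on the side of `x` if `y` belongs to the min-convex hull. -/
theorem Step.exists_closer_left {S : Set Vertex} {x y : Vertex} (h : Step x y)
    (hy : y ∈ minconv S) : ∃ a ∈ S, F a y < F a x := by
  by_contra! hcon
  obtain ⟨L, rfl⟩ := exists_cls x
  obtain ⟨M, rfl, hML, -, hd⟩ := h.exists_le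
  have : L ≤ M := le_of_mem_minconv hy fun A hA hle => by
    have h1 := hcon _ hA
    have h2 := F_le_iff.2 hle
    have h3 := h.F_left_cases (cls A)
    rw [← F_le_iff]
    omega
  exact absurd (deg_anti this) (by omega)

/-- The vertices of `S`, as targets, do not all lie on the side of `y` if `x` belongs to the
max-convex hull. -/
theorem Step.exists_closer_right {S : Set Vertex} {x y : Vertex} (h : Step x y)
    (hx : x ∈ maxconv S) : ∃ b ∈ S, F x b < F y b := by
  by_contra! hcon
  obtain ⟨L, rfl⟩ := exists_cls x
  obtain ⟨M, rfl, hML, -, hd⟩ := h.exists_le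
  have : L ≤ M := le_of_mem_maxconv hx fun A hA hle => by
    have h1 := hcon _ hA
    have h2 := F_le_iff.2 hle
    have h3 := h.F_right_cases (cls A)
    rw [← F_le_iff]
    omega
  exact absurd (deg_anti this) (by omega)

/-- A vertex of the max-convex hull of `S` lies on a shortest path from any given vertex to some
vertex of `S`. -/
theorem exists_F_eq_add {S : Set Vertex} {x : Vertex} (hx : x ∈ maxconv S) (a : Vertex) :
    ∃ b ∈ S, F a b = F a x + F x b := by
  by_contra! hcon
  obtain ⟨L, rfl⟩ := exists_cls x
  obtain ⟨A, rfl, hLA, hA⟩ := exists_ge_rep L a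
  have hdeg : (A.scale 1).deg = A.deg + 3 := by rw [deg_scale]; ring
  have : L ≤ A.scale 1 := le_of_mem_maxconv hx fun B hB hle => by
    have h1 := hcon _ hB
    have h2 := F_le_iff.2 hle
    have h3 := F_triangle (cls A) (cls L) (cls B)
    have h4 := F_cocycle (cls A) (cls L) (cls B)
    rw [← F_le_iff, cls_scale]
    omega
  have := F_le_iff.2 this
  rw [cls_scale] at this
  omega

/-- A vertex of the min-convex hull of `S` is determined by its distances from the vertices of
`S`. -/
theorem eq_of_forall_F_eq {S : Set Vertex} {x y : Vertex} (hS : S.Nonempty) (hx : x ∈ minconv S)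
    (hy : y ∈ minconv S) (h : ∀ a ∈ S, F a x = F a y) : x = y := by
  obtain ⟨L, rfl⟩ := exists_cls x
  obtain ⟨M₀, rfl⟩ := exists_cls y
  obtain ⟨a, ha⟩ := hS
  obtain ⟨A, rfl⟩ := exists_cls a
  obtain ⟨M, hM, hdeg⟩ : ∃ M, cls M = cls M₀ ∧ M.deg = L.deg := by
    refine ⟨M₀.scale ((L.deg - M₀.deg) / 3), cls_scale _ _, ?_⟩
    have h1 := F_emod A L
    have h2 := F_emod A M₀
    have h3 := h _ ha
    rw [deg_scale]
    omega
  rw [← hM] at h hy ⊢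
  have h1 : L ≤ M := le_of_mem_minconv hy fun B hB hle => by
    have h2 := F_le_iff.2 hle
    have h3 := h _ hB
    rw [← F_le_iff]
    omega
  rw [eq_of_le_of_deg_le h1 hdeg.ge]

/-- By `exists_F_eq_add`, the distances from `S` to its convex hull are bounded by the diameter of
`S`, and by `eq_of_forall_F_eq` they determine the vertex. -/
theorem finite_conv {S : Set Vertex} (hS : S.Finite) (hne : S.Nonempty) : (conv S).Finite := by
  have := hS.to_subtype
  obtain ⟨C, hC⟩ : ∃ C : ℤ, ∀ a ∈ S, ∀ b ∈ S, F a b ≤ C := by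
    obtain ⟨C, hC⟩ := ((hS.prod hS).image fun p => F p.1 p.2).bddAbove
    exact ⟨C, fun a ha b hb => hC ⟨(a, b), ⟨ha, hb⟩, rfl⟩⟩
  have hfin : (Set.univ.pi fun _ : S => Set.Icc (0 : ℤ) C).Finite :=
    Set.Finite.pi fun _ => Set.finite_Icc _ _
  refine Set.Finite.of_finite_image (f := fun x => fun a : S => F a x) (hfin.subset ?_) ?_
  · rintro _ ⟨x, hx, rfl⟩ a -
    refine ⟨F_nonneg _ _, ?_⟩
    obtain ⟨b, hb, h⟩ := exists_F_eq_add hx.2 a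
    have h1 := hC a a.2 b hb
    have h2 := F_nonneg x b
    show F a x ≤ C
    omega
  · intro x hx y hy hxy
    exact eq_of_forall_F_eq hne hx.1 hy.1 fun a ha => congrFun hxy ⟨a, ha⟩

/-! ### Contracting a convex hull towards a vertex -/

theorem adj_of_between {L W : OLattice} (h1 : W ≤ L) (h2 : L.scale 1 ≤ W)
    (hd : W.deg = L.deg + 1 ∨ W.deg = L.deg + 2) : Adj (cls L) (cls W) := by
  rw [adj_iff_step]
  rcases hd with hd | hd
  · exact Or.inl (Step.of_le h1 h2 hd)
  · exact Or.inr (Step.of_le' h1 h2 hd)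

/-- The neighbours of `[L]` that are closer to `[B]` are given by the lattices between `t L + B` and
`L`, if `B` is maximal in `L`. -/
theorem exists_rep_of_closer {L B : OLattice} {w : Vertex} (hB : F (cls L) (cls B) = B.deg - L.deg)
    (hw : Adj (cls L) w) (hc : F w (cls B) < F (cls L) (cls B)) :
    ∃ W, cls W = w ∧ W ≤ L ∧ (L.scale 1).sum B ≤ W ∧
      (W.deg = L.deg + 1 ∨ W.deg = L.deg + 2) := by
  rcases adj_iff_step.1 hw with h | h
  · obtain ⟨W, rfl, h1, h2, h3⟩ := h.exists_le
    have := h.F_right_cases (cls B)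
    exact ⟨W, rfl, h1, sum_le h2 (by rw [← F_le_iff]; omega), Or.inl h3⟩
  · obtain ⟨W, rfl, h1, h2, h3⟩ := h.exists_le'
    have := h.F_right_cases (cls B)
    exact ⟨W, rfl, h1, sum_le h2 (by rw [← F_le_iff]; omega), Or.inr h3⟩

theorem not_adj_of_deg_eq {L M : OLattice} (h : L.deg = M.deg) : ¬ Adj (cls L) (cls M) := by
  rw [adj_iff_step]
  have := F_emod L M
  rintro (h1 | h1)
  · have := h1.1
    omega
  · have := h1.2
    omega

theorem three_le_F_add_F {x y : Vertex} (h : x ≠ y) : 3 ≤ F x y + F y x := by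
  have h1 := F_cocycle x y x
  have h2 := F_nonneg x y
  have h3 := F_nonneg y x
  have h4 : F x y ≠ 0 := fun h0 => h (F_eq_zero_iff.1 h0)
  rw [F_self] at h1
  omega

variable {n : ℕ} {P : ZMod n → Vertex}

/-- Let `t L ⊂ W ⊂ M ⊂ L` be a full flag such that `[W]` is not a vertex of `P` and no lattice
with class in `P` separates `W` from `M`, neither from inside `M` nor from outside `W`. If `P c`
lies in the direction `W` seen from `L`, that is, if its largest representative `B` inside `L` is
contained in `W`, then `P (c + 1)` lies in this direction too. Otherwise `[L]` lies on a shortest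
path from `P c` to `P (c + 1)`. If `[L]` is `P (c + 1)`, it follows that `[W]` is `P c`; if not,
`[W]` lies on a shortest path from `P (c + 1)` to `P c`, and the two paths are too long for
adjacent vertices. -/
theorem direction_succ (hP : ∀ i, Adj (P i) (P (i + 1))) {L W M : OLattice}
    (hLW : L.scale 1 ≤ W) (hWM : W ≤ M) (hML : M ≤ L) (hWd : W.deg = L.deg + 2)
    (hMd : M.deg = L.deg + 1) (hW : cls W ∉ Set.range P)
    (h1 : ∀ B, cls B ∈ Set.range P → B ≤ M → B ≤ W)
    (h2 : ∀ A, cls A ∈ Set.range P → W ≤ A → M ≤ A) {c : ZMod n} {B : OLattice}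
    (hBc : cls B = P c) (hBW : B ≤ W) (hB : F (cls L) (P c) = B.deg - L.deg) :
    ∃ B', cls B' = P (c + 1) ∧ B' ≤ W ∧ F (cls L) (P (c + 1)) = B'.deg - L.deg := by
  obtain ⟨B', hBc', hBL', hB'⟩ := exists_le_rep L (P (c + 1))
  refine ⟨B', hBc', ?_, hB'⟩
  by_contra hBW'
  have hBM' : ¬ B' ≤ M := fun h => hBW' (h1 B' ⟨_, hBc'.symm⟩ h)
  have hLdeg : (L.scale 1).deg = L.deg + 3 := by rw [deg_scale]; ring
  have sLM : Step (cls L) (cls M) := Step.of_le hML (hLW.trans hWM) hMd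
  have sWL : Step (cls W) (cls L) := Step.of_le' (hWM.trans hML) hLW hWd
  have hvc : cls L ≠ P c := fun he => by
    rw [he, F_self] at hB
    have := deg_anti hBW
    omega
  have hBtL : ¬ B ≤ L.scale 1 := by rw [← F_le_iff, hBc, cls_scale]; omega
  have hWsum : W = (L.scale 1).sum B := eq_sum hLW hBW hBtL (by omega)
  obtain ⟨A, hAc, hLA, hA⟩ := exists_ge_rep L (P c)
  have hAdeg : (A.scale 1).deg = A.deg + 3 := by rw [deg_scale]; ring
  have hWA : W ≤ A.scale 1 := by
    rw [hWsum]
    exact sum_le (scale_mono 1 hLA) (le_scale_one (hBW.trans (hWM.trans hML)) hLA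
      (hAc.trans hBc.symm) (hAc ▸ hvc))
  have hMA : M ≤ A.scale 1 := h2 _ (by rw [cls_scale, hAc]; exact ⟨c, rfl⟩) hWA
  rw [← F_le_iff, cls_scale, hAc] at hMA
  have e1 : F (P c) (P (c + 1)) = F (P c) (cls L) + F (cls L) (P (c + 1)) := by
    refine sLM.F_eq_add (by omega) ?_
    rw [← F_le_iff, hBc'] at hBM'
    have := sLM.F_right_cases (P (c + 1))
    omega
  have hadj := adj_iff.1 (hP c)
  have hge := three_le_F_add_F hvc
  by_cases hvc' : cls L = P (c + 1)
  · rw [hvc'] at hB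
    have hBe : B = W := by
      refine eq_of_le_of_deg_le hBW ?_
      have h3 := F_nonneg (P c) (P (c + 1))
      have h4 : F (P c) (P (c + 1)) ≠ 0 := fun h => (hP c).ne (F_eq_zero_iff.1 h)
      omega
    exact hW (by rw [← hBe, hBc]; exact ⟨c, rfl⟩)
  · obtain ⟨A', hAc', hLA', hA'⟩ := exists_ge_rep L (P (c + 1))
    have hAdeg' : (A'.scale 1).deg = A'.deg + 3 := by rw [deg_scale]; ring
    have hLA1 : ¬ L ≤ A'.scale 1 := by
      rw [← F_le_iff, cls_scale, hAc']; omega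
    have hWA' : ¬ W ≤ A'.scale 1 := fun h => by
      have h3 : M ≤ A'.scale 1 := h2 _ (by rw [cls_scale, hAc']; exact ⟨_, rfl⟩) h
      apply hBM'
      rw [eq_inter hML h3 hLA1 hMd]
      exact le_inter hBL' (le_scale_one hBL' hLA' (hAc'.trans hBc'.symm) (hAc' ▸ hvc'))
    rw [← F_le_iff, cls_scale, hAc'] at hWA'
    have e2 : F (P (c + 1)) (P c) = F (P (c + 1)) (cls W) + F (cls W) (P c) := by
      refine sWL.F_eq_add ?_ ?_
      · have := sWL.F_left_cases (P (c + 1))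
        omega
      · have := F_le_iff.2 hBW
        rw [hBc] at this
        omega
    have e3 := F_triangle (P (c + 1)) (cls L) (cls W)
    have e4 := sWL.F_left_cases (P (c + 1))
    have e5 := sWL.F_right_cases (P c)
    have hge' := three_le_F_add_F hvc'
    omega

/-- Every vertex `v` of the hull other than `o = P j` has a neighbour `w₀` in the hull that is
closer to `o`, such that the closer neighbours of `v` form a star with centre `w₀`.

Let `v = [L]`, let `B` be the largest representative of `o` inside `L` and `A` the smallest one
containing `L`. The closer neighbours are given by lattices between `W = t L + B` and `L`. If
`[W]` is in the hull, it is the centre. Otherwise `M = L ∩ t A` gives the only closer neighbour;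
it belongs to the hull, since by `direction_succ` the whole walk would else lie in the direction
`W`, and `L` would not be a sum of representatives of vertices of `P`. -/
theorem exists_gate [NeZero n] (hP : ∀ i, Adj (P i) (P (i + 1))) {v : Vertex}
    (hv : v ∈ conv (Set.range P)) (j : ZMod n) (hne : v ≠ P j) :
    ∃ w₀ ∈ conv (Set.range P), Adj v w₀ ∧ F w₀ (P j) < F v (P j) ∧
      (∀ w ∈ conv (Set.range P), Adj v w → F w (P j) < F v (P j) → w = w₀ ∨ Adj w w₀) ∧
      (∀ w ∈ conv (Set.range P), ∀ w' ∈ conv (Set.range P), Adj v w → Adj v w' →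
        F w (P j) < F v (P j) → F w' (P j) < F v (P j) → Adj w w' → w = w₀ ∨ w' = w₀) := by
  obtain ⟨L, rfl⟩ := exists_cls v
  obtain ⟨B, hBj, hBL, hB⟩ := exists_le_rep L (P j)
  obtain ⟨A, hAj, hLA, hA⟩ := exists_ge_rep L (P j)
  have hLdeg : (L.scale 1).deg = L.deg + 3 := by rw [deg_scale]; ring
  have hAdeg : (A.scale 1).deg = A.deg + 3 := by rw [deg_scale]; ring
  have hjS : P j ∈ Set.range P := ⟨j, rfl⟩
  have hBtL : ¬ B ≤ L.scale 1 := by rw [← F_le_iff, hBj, cls_scale]; omega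
  have hLA1 : ¬ L ≤ A.scale 1 := by rw [← F_le_iff, cls_scale, hAj]; omega
  have hBA : B ≤ A.scale 1 := le_scale_one hBL hLA (hAj.trans hBj.symm) (hAj ▸ hne)
  have hLA' : L.scale 1 ≤ A.scale 1 := scale_mono 1 hLA
  set W := (L.scale 1).sum B with hW
  have hLW : L.scale 1 ≤ W := le_sum_left _ _
  have hBW : B ≤ W := le_sum_right _ _
  have hLL : L.scale 1 ≤ L := scale_le_self_iff.2 (by norm_num)
  have hWL : W ≤ L := sum_le hLL hBL
  have hWA : W ≤ A.scale 1 := sum_le hLA' hBA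
  have hW1 : L.deg < W.deg := deg_lt (lt_of_le_not_ge hWL fun h => hLA1 (h.trans hWA))
  have hW2 : W.deg < L.deg + 3 := by
    rw [← hLdeg]
    exact deg_lt (lt_of_le_not_ge hLW fun h => hBtL (hBW.trans h))
  have hrep : ∀ w, Adj (cls L) w → F w (P j) < F (cls L) (P j) →
      ∃ W', cls W' = w ∧ W' ≤ L ∧ W ≤ W' ∧ (W'.deg = L.deg + 1 ∨ W'.deg = L.deg + 2) := by
    intro w h1 h2
    rw [← hBj] at h2 hB
    exact exists_rep_of_closer hB h1 h2
  have hWmax : cls W ∈ maxconv (Set.range P) :=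
    maxConvex_maxconv _ _ _ (by rw [cls_scale]; exact hv.2)
      (by rw [hBj]; exact subset_maxconv _ hjS)
  by_cases hWmin : cls W ∈ minconv (Set.range P)
  -- `[W]` is the centre: it is adjacent to every lattice properly between `W` and `L`.
  · refine ⟨cls W, ⟨hWmin, hWmax⟩, adj_of_between hWL hLW (by omega), ?_, ?_, ?_⟩
    · have := F_le_iff.2 hBW
      rw [hBj] at this
      omega
    · intro w _ h1 h2
      obtain ⟨W', rfl, h3, h4, h5⟩ := hrep w h1 h2
      have := deg_anti h4
      by_cases hd : W'.deg = W.deg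
      · left
        rw [eq_of_le_of_deg_le h4 (by omega)]
      · right
        exact (Step.of_le h4 ((scale_mono 1 h3).trans hLW) (by omega)).adj
    · intro w _ w' _ h1 h1' h2 h2' hadj
      obtain ⟨X, rfl, h3, h4, h5⟩ := hrep w h1 h2
      obtain ⟨Y, rfl, h3', h4', h5'⟩ := hrep w' h1' h2'
      have hdne : X.deg ≠ Y.deg := fun h => not_adj_of_deg_eq h hadj
      by_cases hd : X.deg = L.deg + 2
      · left
        rw [eq_of_le_of_deg_le h4 (by omega)]
      · right
        rw [eq_of_le_of_deg_le h4' (by omega)]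
  -- `[W]` is not in the hull, and `M = L ∩ t A` has colength one in `L`.
  · set M := L.inter (A.scale 1) with hM
    have hWM : W ≤ M := le_inter hWL hWA
    have hML : M ≤ L := inter_le_left _ _
    have hMmin : cls M ∈ minconv (Set.range P) :=
      minConvex_minconv _ _ _ hv.1 (by rw [cls_scale, hAj]; exact subset_minconv _ hjS)
    have hWMne : W ≠ M := fun h => hWmin (h ▸ hMmin)
    have hM1 := deg_lt (lt_of_le_of_ne hWM hWMne)
    have hM2 : L.deg < M.deg := deg_lt (lt_of_le_not_ge hML fun h =>
      hLA1 (h.trans (inter_le_right _ _)))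
    have hMmax : cls M ∈ maxconv (Set.range P) := by
      by_contra hMmax
      have h1 : ∀ B, cls B ∈ Set.range P → B ≤ M → B ≤ W := by
        intro B hBS hBM
        by_contra hBW
        apply hMmax
        rw [eq_sum hWM hBM hBW (by omega)]
        exact maxConvex_maxconv _ _ _ hWmax (subset_maxconv _ hBS)
      have h2 : ∀ A, cls A ∈ Set.range P → W ≤ A → M ≤ A := by
        intro A hAS hWA
        by_contra hMA
        apply hWmin
        rw [eq_inter hWM hWA hMA (by omega)]
        exact minConvex_minconv _ _ _ hMmin (subset_minconv _ hAS)
      have hall : ∀ k : ℕ, ∃ B', cls B' = P (j + k) ∧ B' ≤ W ∧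
          F (cls L) (P (j + k)) = B'.deg - L.deg := by
        intro k
        induction k with
        | zero => exact ⟨B, by simpa using hBj, hBW, by simpa using hB⟩
        | succ k ih =>
          obtain ⟨B', h3, h4, h5⟩ := ih
          have := direction_succ hP hLW hWM hML (by omega) (by omega)
            (fun h => hWmin (subset_minconv _ h)) h1 h2 h3 h4 h5
          rwa [add_assoc, ← Nat.cast_succ] at this
      have hLW' : L ≤ W := le_of_mem_maxconv hv.2 fun C hC hCL => by
        obtain ⟨c, hc⟩ := hC
        obtain ⟨B', h3, h4, h5⟩ := hall (c - j).val
        rw [ZMod.natCast_val, ZMod.cast_id', id, add_sub_cancel, hc] at h3 h5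
        have h6 := F_le_iff.2 hCL
        obtain ⟨k, rfl⟩ := cls_eq_iff.1 h3
        rw [deg_scale] at h6
        exact (scale_le_self_iff.2 (by omega)).trans h4
      have := deg_anti hLW'
      omega
    have huniq : ∀ w ∈ conv (Set.range P), Adj (cls L) w → F w (P j) < F (cls L) (P j) →
        w = cls M := by
      intro w hw h1 h2
      obtain ⟨W', rfl, h3, h4, h5⟩ := hrep w h1 h2
      have hd : W'.deg = L.deg + 1 := by
        by_contra hd
        rw [← eq_of_le_of_deg_le h4 (by omega)] at hw
        exact hWmin hw.1
      have hW'M : W' ≤ M := by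
        by_contra hnot
        apply hWmin
        rw [eq_inter h4 hWM hnot (by omega)]
        exact minConvex_minconv _ _ _ hw.1 hMmin
      rw [eq_of_le_of_deg_le hW'M (by omega)]
    refine ⟨cls M, ⟨hMmin, hMmax⟩, adj_of_between hML (hLW.trans hWM) (by omega), ?_, ?_, ?_⟩
    · have := F_le_iff.2 (hBW.trans hWM)
      rw [hBj] at this
      omega
    · exact fun w hw h1 h2 => Or.inl (huniq w hw h1 h2)
    · exact fun w hw w' _ h1 _ h2 _ _ => Or.inl (huniq w hw h1 h2)

end A2

/-! ### Cyclic patterns of labels -/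

section Cyclic

variable {n : ℕ}

theorem exists_intCast_eq_mem_Ico [NeZero n] (j : ZMod n) (a : ℤ) :
    ∃ b : ℤ, a ≤ b ∧ b < a + n ∧ (b : ZMod n) = j := by
  refine ⟨a + ((j - a).val : ℕ), by omega, ?_, ?_⟩
  · have := ZMod.val_lt (j - (a : ZMod n))
    omega
  · push_cast
    rw [ZMod.natCast_val, ZMod.cast_id', id, add_sub_cancel]

/-- Between an element of `R` and a later element of `S` there are consecutive elements of `R ∪ S`
with the first in `R` and the second in `S`. -/
theorem exists_consecutive {R S : ℤ → Prop} {i j : ℤ} (hij : i < j) (hi : R i) (hj : S j) :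
    ∃ i' j', i' < j' ∧ R i' ∧ S j' ∧ ∀ k, i' < k → k < j' → ¬ R k ∧ ¬ S k := by
  induction h : (j - i).toNat using Nat.strong_induction_on generalizing i j with
  | _ m ih =>
    by_cases hk : ∃ k, i < k ∧ k < j ∧ (R k ∨ S k)
    · obtain ⟨k, h1, h2, h3 | h3⟩ := hk
      · exact ih (j - k).toNat (by omega) h2 h3 hj rfl
      · exact ih (k - i).toNat (by omega) h1 hi h3 rfl
    · push Not at hk
      exact ⟨i, j, hij, hi, hj, fun k h1 h2 => hk k h1 h2⟩

/-- The labels `0`, `1`, `2` occur in this cyclic order. -/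
def OrdPos (f : ZMod n → Fin 3) : Prop :=
  ∃ a b c : ℤ, a < b ∧ b < c ∧ c < a + n ∧ f a = 0 ∧ f b = 1 ∧ f c = 2

/-- The labels `0`, `2`, `1` occur in this cyclic order. -/
def OrdNeg (f : ZMod n → Fin 3) : Prop :=
  ∃ a b c : ℤ, a < b ∧ b < c ∧ c < a + n ∧ f a = 0 ∧ f b = 2 ∧ f c = 1

theorem ordPos_or_ordNeg [NeZero n] {f : ZMod n → Fin 3} (hf : Function.Surjective f) :
    OrdPos f ∨ OrdNeg f := by
  obtain ⟨x, hx⟩ := hf 0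
  obtain ⟨y, hy⟩ := hf 1
  obtain ⟨z, hz⟩ := hf 2
  obtain ⟨a, -, -, rfl⟩ := exists_intCast_eq_mem_Ico x 0
  obtain ⟨b, hb1, hb2, rfl⟩ := exists_intCast_eq_mem_Ico y a
  obtain ⟨c, hc1, hc2, rfl⟩ := exists_intCast_eq_mem_Ico z a
  have h1 : a ≠ b := by rintro rfl; simp [hx] at hy
  have h2 : a ≠ c := by rintro rfl; simp [hx] at hz
  have h3 : b ≠ c := by rintro rfl; simp [hy] at hz
  rcases lt_or_gt_of_ne h3 with h | h
  · exact Or.inl ⟨a, b, c, by omega, h, hc2, hx, hy, hz⟩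
  · exact Or.inr ⟨a, c, b, by omega, h, hb2, hx, hz, hy⟩

/-- The cyclic patterns `r = i`, `r = j`, `s = j`, `s = i` with `i ≠ j` do not occur. -/
def Noncrossing (r s : ZMod n → Fin 3) : Prop :=
  ∀ a a' b b' : ℤ, a < a' → a' < b → b < b' → b' < a + n → r a = s b' → r a' = s b → r a = r a'

theorem Noncrossing.symm {r s : ZMod n → Fin 3} (h : Noncrossing r s) : Noncrossing s r := by
  intro a a' b b' h1 h2 h3 h4 h5 h6
  have := h b b' (a + n) (a' + n) h3 (by omega) (by omega) (by omega) (by simpa using h6.symm)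
    (by simpa using h5.symm)
  rw [h5, h6, this]

/-- For a noncrossing pair of labellings, the cyclic order of the labels of `r` forces that of the
labels of `s`. -/
theorem Noncrossing.not_ordNeg [NeZero n] {r s : ZMod n → Fin 3} (h : Noncrossing r s)
    (hne : ∀ j, r j ≠ s j) (hr : OrdPos r) : ¬ OrdNeg s := by
  rintro ⟨b₁', b₃', b₂', h13, h32, h21, hs1', hs3', hs2'⟩
  obtain ⟨a₁, a₂, a₃, h12, h23, h31, hr1, hr2, hr3⟩ := hr
  -- The six positions are compared inside the window from `a₁` to `a₁ + n`.
  have key : ∀ b₁ b₂ b₃ : ℤ, a₁ ≤ b₁ → b₁ < a₁ + n → a₁ ≤ b₂ → b₂ < a₁ + n → a₁ ≤ b₃ →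
      b₃ < a₁ + n → s b₁ = 0 → s b₂ = 1 → s b₃ = 2 →
      (b₁ < b₃ ∧ b₃ < b₂ ∨ b₃ < b₂ ∧ b₂ < b₁ ∨ b₂ < b₁ ∧ b₁ < b₃) → False := by
    intro b₁ b₂ b₃ l1 u1 l2 u2 l3 u3 hs1 hs2 hs3 hord
    have n1 : b₁ ≠ a₁ := by rintro rfl; exact hne _ (hr1.trans hs1.symm)
    have n2 : b₂ ≠ a₂ := by rintro rfl; exact hne _ (hr2.trans hs2.symm)
    have n3 : b₃ ≠ a₃ := by rintro rfl; exact hne _ (hr3.trans hs3.symm)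
    have c12 : ¬ (a₂ < b₂ ∧ b₂ < b₁) := by
      rintro ⟨p, q⟩
      have := h a₁ a₂ b₂ b₁ h12 p q u1 (hr1.trans hs1.symm) (hr2.trans hs2.symm)
      rw [hr1, hr2] at this
      exact absurd this (by decide)
    have c31 : ¬ (b₁ < b₃ ∧ b₃ < a₃) := by
      rintro ⟨p, q⟩
      have := h a₃ (a₁ + n) (b₁ + n) (b₃ + n) h31 (by omega) (by omega) (by omega)
        (by simpa using hr3.trans hs3.symm) (by simpa using hr1.trans hs1.symm)
      simp [hr1, hr3] at this
    have c23 : ¬ (a₃ < b₃ ∧ b₃ < b₂) := by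
      rintro ⟨p, q⟩
      have := h a₂ a₃ b₃ b₂ h23 p q (by omega) (hr2.trans hs2.symm) (hr3.trans hs3.symm)
      rw [hr2, hr3] at this
      exact absurd this (by decide)
    have c23' : ¬ (a₃ < b₃ ∧ b₂ < a₂) := by
      rintro ⟨p, q⟩
      have := h a₂ a₃ b₃ (b₂ + n) h23 p (by omega) (by omega)
        (by simpa using hr2.trans hs2.symm) (hr3.trans hs3.symm)
      rw [hr2, hr3] at this
      exact absurd this (by decide)
    have c23'' : ¬ (b₃ < b₂ ∧ b₂ < a₂) := by
      rintro ⟨p, q⟩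
      have := h a₂ a₃ (b₃ + n) (b₂ + n) h23 (by omega) (by omega) (by omega)
        (by simpa using hr2.trans hs2.symm) (by simpa using hr3.trans hs3.symm)
      rw [hr2, hr3] at this
      exact absurd this (by decide)
    omega
  obtain ⟨b₁, l1, u1, hb1⟩ := exists_intCast_eq_mem_Ico (b₁' : ZMod n) a₁
  have e2 : ((b₂' - b₁' + b₁ : ℤ) : ZMod n) = (b₂' : ZMod n) := by push_cast; rw [hb1]; ring
  have e3 : ((b₃' - b₁' + b₁ : ℤ) : ZMod n) = (b₃' : ZMod n) := by push_cast; rw [hb1]; ring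
  generalize hb2 : b₂' - b₁' + b₁ = b₂ at e2
  generalize hb3 : b₃' - b₁' + b₁ = b₃ at e3
  rw [← hb1] at hs1'
  rw [← e2] at hs2'
  rw [← e3] at hs3'
  have hs2'' : s ((b₂ - n : ℤ) : ZMod n) = 1 := by simpa using hs2'
  have hs3'' : s ((b₃ - n : ℤ) : ZMod n) = 2 := by simpa using hs3'
  by_cases q2 : b₂ < a₁ + n
  · exact key b₁ b₂ b₃ l1 u1 (by omega) q2 (by omega) (by omega) hs1' hs2' hs3' (by omega)
  by_cases q3 : b₃ < a₁ + n
  · exact key b₁ (b₂ - n) b₃ l1 u1 (by omega) (by omega) (by omega) q3 hs1' hs2'' hs3' (by omega)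
  · exact key b₁ (b₂ - n) (b₃ - n) l1 u1 (by omega) (by omega) (by omega) (by omega) hs1'
      hs2'' hs3'' (by omega)

theorem Noncrossing.not_ordPos_ordNeg [NeZero n] {r s : ZMod n → Fin 3} (h : Noncrossing r s)
    (hne : ∀ j, r j ≠ s j) (hs : Function.Surjective s) (h1 : OrdPos r) (h2 : OrdNeg r) :
    False := by
  rcases ordPos_or_ordNeg hs with h3 | h3
  · exact h.symm.not_ordNeg (fun j => (hne j).symm) h3 h2
  · exact h.not_ordNeg hne h1 h3

/-- A local four-point inequality on unit squares off the diagonal extends to rectangles. -/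
theorem four_point_of_unit {g : ℤ → ℤ → ℤ}
    (hg : ∀ c d : ℤ, c < d → d < c + n → g c (d + 1) + g (c + 1) d ≤ g c d + g (c + 1) (d + 1))
    {a a' b b' : ℤ} (h1 : a ≤ a') (h2 : a' ≤ b) (h3 : b ≤ b') (h4 : b' ≤ a + n) :
    g a b' + g a' b ≤ g a b + g a' b' := by
  have row : ∀ c, a ≤ c → c < b → ∀ b', b ≤ b' → b' ≤ a + n →
      g c b' + g (c + 1) b ≤ g c b + g (c + 1) b' := by
    intro c hc hcb b' hb
    induction b', hb using Int.leInduction with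
    | base => intro _; omega
    | succ m hm ih =>
      intro hle
      have := ih (by omega)
      have := hg c m (by omega) (by omega)
      omega
  induction a', h1 using Int.leInduction with
  | base => omega
  | succ m hm ih =>
    have := ih (by omega)
    have := row m hm (by omega) b' h3 h4
    omega

end Cyclic

namespace A2

/-! ### Polygons satisfying the four-point inequality -/

variable {n : ℕ}

/-- A closed walk in the building whose mutual distances satisfy the four-point inequality of a
convex polygon. -/
structure FourPoint (P : ZMod n → Vertex) : Prop where
  adj : ∀ i, Adj (P i) (P (i + 1))
  le : ∀ c d, c ≠ d → F (P c) (P (d + 1)) + F (P (c + 1)) (P d) ≤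
    F (P c) (P d) + F (P (c + 1)) (P (d + 1))

/-- The local rule of a growth diagram sorts a vector, which does not decrease its first entry;
hence the four-point inequality. -/
theorem fourPoint_of_isGeneric [NeZero n] {P : ZMod n → Vertex} (hP : IsPolygon P)
    (hgen : IsGeneric P) : FourPoint P := by
  refine ⟨fun i => ?_, fun c d hcd => ?_⟩
  · rcases hP i with h | h
    · exact (Step.of_hasDist_omega1 h).adj.symm
    · exact (Step.of_hasDist_omega2 h).adj
  · obtain ⟨k, γ, hγ, hd⟩ := hgen
    obtain ⟨i, hi1, hi2, rfl⟩ : ∃ i : ℕ, 1 ≤ i ∧ i ≤ n ∧ (i : ZMod n) = c := by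
      refine ⟨(c - 1).val + 1, by omega, ZMod.val_lt _, ?_⟩
      push_cast
      rw [ZMod.natCast_val, ZMod.cast_id', id, sub_add_cancel]
    obtain ⟨j, hj1, hj2, rfl⟩ : ∃ j : ℕ, i + 1 ≤ j ∧ j + 1 ≤ i + n ∧ (j : ZMod n) = d := by
      refine ⟨i + (d - i).val, ?_, ?_, ?_⟩
      · have : (d - i).val ≠ 0 := by
          rw [Ne, ZMod.val_eq_zero, sub_eq_zero]
          exact fun h => hcd h.symm
        omega
      · have := ZMod.val_lt (d - (i : ZMod n))
        omega
      · push_cast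
        rw [ZMod.natCast_val, ZMod.cast_id', id, add_sub_cancel]
    have s1 : (i, j) ∈ staircase n := ⟨hi1, by simp; omega, by simp; omega, by simp; omega⟩
    have s2 : (i, j + 1) ∈ staircase n := ⟨hi1, by simp; omega, by simp; omega, by simp; omega⟩
    have s3 : (i + 1, j) ∈ staircase n := ⟨by simp, by simp; omega, by simp; omega, by simp; omega⟩
    have s4 : (i + 1, j + 1) ∈ staircase n :=
      ⟨by simp, by simp; omega, by simp; omega, by simp; omega⟩
    have f1 := (F_of_hasDist (hd _ _ s1)).1
    have f2 := (F_of_hasDist (hd _ _ s2)).1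
    have f3 := (F_of_hasDist (hd _ _ s3)).1
    have f4 := (F_of_hasDist (hd _ _ s4)).1
    push_cast at f2 f3 f4
    obtain ⟨σ, hσ⟩ := hγ.sort i j s1 s2 s3 s4
    have hsum : ∑ r, γ (i + 1) (j + 1) r =
        ∑ r, (γ (i + 1) j r + γ i (j + 1) r - γ i j r) := by
      rw [← Equiv.sum_comp σ (fun r => γ (i + 1) j r + γ i (j + 1) r - γ i j r)]
      exact Finset.sum_congr rfl fun r _ => hσ r
    have hfirst : γ (i + 1) j 0 + γ i (j + 1) 0 - γ i j 0 ≤ γ (i + 1) (j + 1) 0 := by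
      have h1 := hσ (σ.symm 0)
      rw [Equiv.apply_symm_apply] at h1
      rw [← h1]
      exact (hγ.partition _ _ s4).1 (Fin.zero_le _)
    rw [Fin.sum_univ_three, Fin.sum_univ_three] at hsum
    rw [f1, f2, f3, f4]
    omega

variable {P : ZMod n → Vertex}

theorem FourPoint.rect [NeZero n] (hP : FourPoint P) {a a' b b' : ℤ} (h1 : a ≤ a') (h2 : a' ≤ b)
    (h3 : b ≤ b') (h4 : b' ≤ a + n) :
    F (P a) (P b') + F (P a') (P b) ≤ F (P a) (P b) + F (P a') (P b') := by
  refine four_point_of_unit (g := fun a b => F (P a) (P b)) (n := n) (fun c d hcd hdc => ?_)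
    h1 h2 h3 h4
  have hne : (c : ZMod n) ≠ d := by
    intro h
    rw [ZMod.intCast_eq_intCast_iff_dvd_sub] at h
    have := Int.le_of_dvd (by omega) h
    omega
  have := hP.le c d hne
  push_cast
  exact this

/-! ### Orientation of triangles -/

theorem Step.third {u v w : Vertex} (h : Step u v) (h1 : Adj v w) (h2 : Adj w u) :
    Step v w ∧ Step w u := by
  have h3 := F_cocycle u v w
  have h4 := F_cocycle w u v
  have h5 := h.1
  have h6 := h.2
  rcases adj_iff_step.1 h1 with h1 | h1 <;> rcases adj_iff_step.1 h2 with h2 | h2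
  · exact ⟨h1, h2⟩
  all_goals
    have := h1.1
    have := h1.2
    have := h2.1
    have := h2.2
    omega

/-- Among the vertices `u`, `v`, `w`, the vertex `u` is closest to `p`, measured from `p`. -/
def Closest (u v w p : Vertex) : Prop := F p u < F p v ∧ F p u < F p w

theorem Closest.symm {u v w p : Vertex} (h : Closest u v w p) : Closest u w v p := ⟨h.2, h.1⟩

/-- The triangle `u`, `v`, `w` of the convex hull is a face to the left of the directed edge
from `u` to `v`: the closest vertices of the triangle to the vertices of the polygon occur in the
cyclic order `u`, `w`, `v`. -/
def Tri (P : ZMod n → Vertex) (u v w : Vertex) : Prop :=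
  (u ∈ conv (Set.range P) ∧ v ∈ conv (Set.range P) ∧ w ∈ conv (Set.range P)) ∧
  (Adj u v ∧ Adj v w ∧ Adj w u) ∧
  ∃ a b c : ℤ, a < b ∧ b < c ∧ c < a + n ∧
    Closest u v w (P a) ∧ Closest w u v (P b) ∧ Closest v w u (P c)

theorem Tri.rotate {u v w : Vertex} (h : Tri P u v w) : Tri P v w u := by
  obtain ⟨⟨h1, h2, h3⟩, ⟨h4, h5, h6⟩, a, b, c, h7, h8, h9, h10, h11, h12⟩ := h
  refine ⟨⟨h2, h3, h1⟩, ⟨h5, h6, h4⟩, c - n, a, b, by omega, by omega, by omega, ?_, h10, h11⟩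
  simpa using h12

/-- For a triangle with steps `x → y`, `y → z`, `z → x`, numbered `0`, `1`, `2`, and a vertex from
which `x`, `y`, `z` have distances `p`, `q`, `r`: the number of the only step along which this
distance decreases. The step ends in the vertex of the triangle closest to the given one. -/
def leftLabel (p q r : ℤ) : Fin 3 := if q < p then 0 else if r < q then 1 else 2

/-- For a triangle with steps `x → y`, `y → z`, `z → x`, numbered `0`, `1`, `2`, and a vertex to
which `x`, `y`, `z` have distances `p`, `q`, `r`: the number of the only step along which this
distance increases. The step starts in the vertex of the triangle closest to the given one. -/
def rightLabel (p q r : ℤ) : Fin 3 := if p < q then 0 else if q < r then 1 else 2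

section Triangle

variable {x y z : Vertex}

theorem leftLabel_cases (hxy : Step x y) (hyz : Step y z) (hzx : Step z x) (p : Vertex) :
    leftLabel (F p x) (F p y) (F p z) = 0 ∧ F p y = F p x - 2 ∧ F p z = F p x - 1 ∨
    leftLabel (F p x) (F p y) (F p z) = 1 ∧ F p y = F p x + 1 ∧ F p z = F p x - 1 ∨
    leftLabel (F p x) (F p y) (F p z) = 2 ∧ F p y = F p x + 1 ∧ F p z = F p x + 2 := by
  have h1 := hxy.F_left_cases p
  have h2 := hyz.F_left_cases p
  have h3 := hzx.F_left_cases p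
  unfold leftLabel
  split_ifs <;> simp <;> omega

theorem rightLabel_cases (hxy : Step x y) (hyz : Step y z) (hzx : Step z x) (p : Vertex) :
    rightLabel (F x p) (F y p) (F z p) = 0 ∧ F y p = F x p + 2 ∧ F z p = F x p + 1 ∨
    rightLabel (F x p) (F y p) (F z p) = 1 ∧ F y p = F x p - 1 ∧ F z p = F x p + 1 ∨
    rightLabel (F x p) (F y p) (F z p) = 2 ∧ F y p = F x p - 1 ∧ F z p = F x p - 2 := by
  have h1 := hxy.F_right_cases p
  have h2 := hyz.F_right_cases p
  have h3 := hzx.F_right_cases p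
  unfold rightLabel
  split_ifs <;> simp <;> omega

/-- The three vertices of a triangle all lie on shortest paths from `a` to `b` exactly if the
labels of `a` and `b` agree. -/
theorem label_eq_iff (hxy : Step x y) (hyz : Step y z) (hzx : Step z x) (a b : Vertex) :
    leftLabel (F a x) (F a y) (F a z) = rightLabel (F x b) (F y b) (F z b) ↔
      F a b = F a x + F x b ∧ F a b = F a y + F y b ∧ F a b = F a z + F z b := by
  have h1 := hxy.F_eq_add (a := a) (b := b)
  have h2 := hyz.F_eq_add (a := a) (b := b)
  have h3 := hzx.F_eq_add (a := a) (b := b)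
  rcases leftLabel_cases hxy hyz hzx a with ⟨e, h4⟩ | ⟨e, h4⟩ | ⟨e, h4⟩ <;>
  rcases rightLabel_cases hxy hyz hzx b with ⟨e', h5⟩ | ⟨e', h5⟩ | ⟨e', h5⟩ <;>
  rw [e, e'] <;> simp <;> omega

theorem label_ne (hxy : Step x y) (hyz : Step y z) (hzx : Step z x) (a : Vertex) :
    leftLabel (F a x) (F a y) (F a z) ≠ rightLabel (F x a) (F y a) (F z a) := by
  rw [Ne, label_eq_iff hxy hyz hzx, F_self]
  have h1 := F_nonneg a x
  have h2 := F_nonneg x a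
  have h3 := F_nonneg a y
  have h4 := F_nonneg y a
  rintro ⟨h5, h6, -⟩
  exact hxy.adj.ne ((F_eq_zero_iff.1 (by omega : F a x = 0)).symm.trans
    (F_eq_zero_iff.1 (by omega : F a y = 0)))

/-- If the labels of `a`, `b'` and those of `a'`, `b` agree, the triangle lies on shortest paths
for both pairs. By the four-point inequality it then lies on shortest paths for the pairs `a`, `b`
and `a'`, `b'` as well, so that all labels agree. -/
theorem FourPoint.noncrossing [NeZero n] (hP : FourPoint P) (hxy : Step x y) (hyz : Step y z)
    (hzx : Step z x) :
    Noncrossing (fun j => leftLabel (F (P j) x) (F (P j) y) (F (P j) z))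
      (fun j => rightLabel (F x (P j)) (F y (P j)) (F z (P j))) := by
  intro a a' b b' h1 h2 h3 h4 h5 h6
  refine Eq.trans ?_ h6.symm
  show leftLabel _ _ _ = rightLabel _ _ _
  have h7 := (label_eq_iff hxy hyz hzx _ _).1 h5
  have h8 := (label_eq_iff hxy hyz hzx _ _).1 h6
  rw [label_eq_iff hxy hyz hzx]
  have h9 := hP.rect h1.le h2.le h3.le h4.le
  have a1 := F_triangle (P a) x (P b)
  have a2 := F_triangle (P a) y (P b)
  have a3 := F_triangle (P a) z (P b)
  have b1 := F_triangle (P a') x (P b')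
  have b2 := F_triangle (P a') y (P b')
  have b3 := F_triangle (P a') z (P b')
  omega

theorem surjective_rightLabel (hxy : Step x y) (hyz : Step y z) (hzx : Step z x)
    (hx : x ∈ maxconv (Set.range P)) (hy : y ∈ maxconv (Set.range P))
    (hz : z ∈ maxconv (Set.range P)) :
    Function.Surjective (fun j => rightLabel (F x (P j)) (F y (P j)) (F z (P j))) := by
  obtain ⟨_, ⟨i, rfl⟩, hi⟩ := hxy.exists_closer_right hx
  obtain ⟨_, ⟨j, rfl⟩, hj⟩ := hyz.exists_closer_right hy
  obtain ⟨_, ⟨k, rfl⟩, hk⟩ := hzx.exists_closer_right hz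
  intro l
  have ci := rightLabel_cases hxy hyz hzx (P i)
  have cj := rightLabel_cases hxy hyz hzx (P j)
  have ck := rightLabel_cases hxy hyz hzx (P k)
  fin_cases l
  · refine ⟨i, ?_⟩
    rcases ci with h | h | h
    · exact h.1
    all_goals omega
  · refine ⟨j, ?_⟩
    rcases cj with h | h | h
    · omega
    · exact h.1
    · omega
  · refine ⟨k, ?_⟩
    rcases ck with h | h | h
    · omega
    · omega
    · exact h.1

theorem closest_iff (hxy : Step x y) (hyz : Step y z) (hzx : Step z x) (p : Vertex) :
    Closest y x z p ↔ F p y < F p x := by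
  have := leftLabel_cases hxy hyz hzx p
  unfold Closest
  omega

theorem leftLabel_of_closest (hxy : Step x y) (hyz : Step y z) (hzx : Step z x) {p : Vertex} :
    (Closest y x z p → leftLabel (F p x) (F p y) (F p z) = 0) ∧
    (Closest z x y p → leftLabel (F p x) (F p y) (F p z) = 1) ∧
    (Closest x y z p → leftLabel (F p x) (F p y) (F p z) = 2) := by
  have := leftLabel_cases hxy hyz hzx p
  unfold Closest
  refine ⟨fun h => ?_, fun h => ?_, fun h => ?_⟩
  · rcases this with h' | h' | h'
    · exact h'.1
    all_goals omega
  · rcases this with h' | h' | h'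
    · omega
    · exact h'.1
    · omega
  · rcases this with h' | h' | h'
    · omega
    · omega
    · exact h'.1

end Triangle

/-- A triangle has only one orientation. -/
theorem FourPoint.not_tri_swap [NeZero n] (hP : FourPoint P) {u v w : Vertex} (h1 : Tri P u v w)
    (h2 : Tri P v u w) : False := by
  have key : ∀ x y z, Step x y → Tri P y x z → Tri P x y z → False := by
    rintro x y z hxy ⟨⟨-, -, -⟩, -, a, b, c, k1, k2, k3, k4, k5, k6⟩
      ⟨⟨hx, hy, hz⟩, ⟨-, hyz, hzx⟩, a', b', c', l1, l2, l3, l4, l5, l6⟩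
    obtain ⟨hyz, hzx⟩ := hxy.third hyz hzx
    have lab := fun p => @leftLabel_of_closest _ _ _ hxy hyz hzx p
    refine (hP.noncrossing hxy hyz hzx).not_ordPos_ordNeg (fun j => label_ne hxy hyz hzx (P j))
      (surjective_rightLabel hxy hyz hzx hx.2 hy.2 hz.2) ?_ ?_
    · exact ⟨a, b, c, k1, k2, k3, (lab _).1 k4, (lab _).2.1 k5.symm, (lab _).2.2 k6.symm⟩
    · refine ⟨c' - n, a', b', by omega, l1, by omega, (lab _).1 ?_, (lab _).2.2 l4,
        (lab _).2.1 l5⟩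
      simpa using l6.symm
  rcases adj_iff_step.1 h1.2.1.1 with h | h
  · exact key u v w h h2 h1
  · exact key v u w h h1 h2

/-- Opposite a face to the left of the edge from `u` to `v`, the polygon does not pass directly
from the side of `u` to the side of `v`. -/
theorem FourPoint.not_closest_succ [NeZero n] (hP : FourPoint P) {u v w : Vertex}
    (h : Tri P u v w) {i : ℤ} (hu : Closest u v w (P i)) (hv : Closest v u w (P (i + 1))) :
    False := by
  obtain ⟨⟨h1, h2, h3⟩, ⟨h4, h5, h6⟩, a, b, c, -, -, -, -, hw, -⟩ := id h
  obtain ⟨b', l1, l2, hb⟩ := exists_intCast_eq_mem_Ico (b : ZMod n) i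
  rw [← hb] at hw
  have hv' : Closest v u w (P ((i + 1 : ℤ) : ZMod n)) := by push_cast; exact hv
  have n1 : b' ≠ i := by
    rintro rfl
    have := hw.1
    have := hu.2
    omega
  have n2 : b' ≠ i + 1 := by
    rintro rfl
    have := hw.2
    have := hv'.2
    omega
  refine hP.not_tri_swap h ⟨⟨h2, h1, h3⟩, ⟨h4.symm, h6.symm, h5.symm⟩, i + 1, b', i + n,
    by omega, by omega, by omega, hv', hw.symm, ?_⟩
  simpa using hu.symm

theorem closest_self {u v w : Vertex} (h1 : u ≠ v) (h2 : u ≠ w) : Closest u v w u := by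
  have a1 := F_nonneg u v
  have a2 := F_nonneg u w
  have a3 : F u v ≠ 0 := fun h => h1 (F_eq_zero_iff.1 h)
  have a4 : F u w ≠ 0 := fun h => h2 (F_eq_zero_iff.1 h)
  unfold Closest
  rw [F_self]
  omega

/-- A directed edge of the polygon has no face to its left. -/
theorem FourPoint.not_tri_bdry [NeZero n] (hP : FourPoint P) {i : ZMod n} {w : Vertex} :
    ¬ Tri P (P i) (P (i + 1)) w := by
  intro h
  obtain ⟨i, -, -, rfl⟩ := exists_intCast_eq_mem_Ico i 0
  exact hP.not_closest_succ h (closest_self h.2.1.1.ne h.2.1.2.2.ne.symm)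
    (closest_self h.2.1.1.ne.symm h.2.1.2.1.ne)

/-- The four-point inequality forbids the polygon to traverse a directed edge twice. -/
theorem FourPoint.bdry_unique [NeZero n] (hP : FourPoint P) {i j : ZMod n} (h1 : P i = P j)
    (h2 : P (i + 1) = P (j + 1)) : i = j := by
  by_contra hne
  have h3 := hP.le i j hne
  have h4 := adj_iff.1 (hP.adj i)
  rw [← h2, ← h1, F_self, F_self] at h3
  omega

/-- An edge of the building between the two sides of the step from `x` to `y` is this step itself.
-/
theorem Step.eq_of_adj {x y a b : Vertex} (h : Step x y) (hab : Adj a b) (ha : F a y < F a x)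
    (hb : F x b < F y b) : a = y ∧ b = x := by
  have h1 := h.F_eq_add ha hb
  have h2 := h.F_left_cases a
  have h3 := F_nonneg a y
  have h4 := F_nonneg x b
  have h5 : F a b = 1 ∨ F a b = 2 := by
    rcases adj_iff_step.1 hab with h | h
    · exact Or.inl h.1
    · exact Or.inr h.2
  exact ⟨F_eq_zero_iff.1 (by omega), (F_eq_zero_iff.1 (by omega)).symm⟩

/-- Let `R` be the set of indices of polygon vertices from which `y` is closer than `x`, and `S`
the set of those to which `x` is closer than `y`. Going around the polygon from `R` to `S`, one
either passes directly from `y` to `x` along an edge of the polygon, or leaves `R` at an index `c`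
outside `R ∪ S`; similarly in the other direction. The triangles on the corresponding side of the
edge lie towards `P c`. -/
theorem FourPoint.exists_left [NeZero n] (hP : FourPoint P) {x y : Vertex}
    (hx : x ∈ conv (Set.range P)) (hy : y ∈ conv (Set.range P)) (h : Step x y) :
    ((∃ i, P i = y ∧ P (i + 1) = x) ∨ ∃ c i : ℤ, c = i + 1 ∧ F (P i) y < F (P i) x ∧
      F (P c) x < F (P c) y ∧ F y (P c) < F x (P c)) ∧
    ((∃ i, P i = x ∧ P (i + 1) = y) ∨ ∃ c i : ℤ, i = c + 1 ∧ F (P i) y < F (P i) x ∧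
      F (P c) x < F (P c) y ∧ F y (P c) < F x (P c)) := by
  obtain ⟨_, ⟨i₀, rfl⟩, hi₀⟩ := h.exists_closer_left hy.1
  obtain ⟨_, ⟨j₀, rfl⟩, hj₀⟩ := h.exists_closer_right hx.2
  let R : ℤ → Prop := fun i => F (P i) y < F (P i) x
  let S : ℤ → Prop := fun j => F x (P j) < F y (P j)
  have hR : ∀ k, ¬ R k → F (P k) x < F (P k) y := fun k hk => by
    have := h.F_left_cases (P k)
    have : ¬ F (P k) y < F (P k) x := hk
    omega
  have hS : ∀ k, ¬ S k → F y (P k) < F x (P k) := fun k hk => by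
    have := h.F_right_cases (P k)
    have : ¬ F x (P k) < F y (P k) := hk
    omega
  constructor
  · obtain ⟨i₁, -, -, rfl⟩ := exists_intCast_eq_mem_Ico i₀ 0
    obtain ⟨j₁, hj, -, rfl⟩ := exists_intCast_eq_mem_Ico j₀ (i₁ + 1)
    obtain ⟨i, j, hij, hi, hj, hk⟩ := exists_consecutive (R := R) (S := S)
      (show i₁ < j₁ by omega) hi₀ hj₀
    by_cases hji : j = i + 1
    · left
      subst hji
      have hj' : F x (P (i + 1)) < F y (P (i + 1)) := by
        have : F x (P ((i + 1 : ℤ) : ZMod n)) < F y (P ((i + 1 : ℤ) : ZMod n)) := hj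
        simpa using this
      exact ⟨i, h.eq_of_adj (hP.adj i) hi hj'⟩
    · right
      obtain ⟨k1, k2⟩ := hk (i + 1) (by omega) (by omega)
      exact ⟨i + 1, i, rfl, hi, hR _ k1, hS _ k2⟩
  · obtain ⟨j₁, -, -, rfl⟩ := exists_intCast_eq_mem_Ico j₀ 0
    obtain ⟨i₁, hi, -, rfl⟩ := exists_intCast_eq_mem_Ico i₀ (j₁ + 1)
    obtain ⟨j, i, hji, hj, hi, hk⟩ := exists_consecutive (R := S) (S := R)
      (show j₁ < i₁ by omega) hj₀ hi₀
    by_cases hij : i = j + 1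
    · left
      subst hij
      have hi' : F (P (j + 1)) y < F (P (j + 1)) x := by
        have : F (P ((j + 1 : ℤ) : ZMod n)) y < F (P ((j + 1 : ℤ) : ZMod n)) x := hi
        simpa using this
      exact ⟨j, (h.eq_of_adj (hP.adj j).symm hi' hj).symm⟩
    · right
      obtain ⟨k1, k2⟩ := hk (i - 1) (by omega) (by omega)
      exact ⟨i - 1, i, by omega, hi, hR _ k2, hS _ k1⟩

/-- A directed edge of the hull which is not an edge of the polygon has a face to its left, namely
the triangle of `Step.exists_third` in the direction of the vertex `P c` of
`FourPoint.exists_left`. -/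
theorem FourPoint.exists_tri [NeZero n] (hP : FourPoint P) {u v : Vertex}
    (hu : u ∈ conv (Set.range P)) (hv : v ∈ conv (Set.range P)) (h : Adj u v) :
    (∃ i, P i = u ∧ P (i + 1) = v) ∨ ∃ w, Tri P u v w := by
  have third : ∀ {x y c}, x ∈ conv (Set.range P) → y ∈ conv (Set.range P) →
      c ∈ Set.range P → Step x y → F c x < F c y → F y c < F x c →
      ∃ z ∈ conv (Set.range P), Step y z ∧ Step z x ∧ F c z < F c y := by
    intro x y c hx hy hc h h1 h2
    obtain ⟨z, h3, h4, h5, -, h6, h7⟩ := h.exists_third h1 h2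
    exact ⟨z, ⟨h6 _ (minConvex_minconv _) hy.1 (subset_minconv _ hc),
      h7 _ (maxConvex_maxconv _) hx.2 (subset_maxconv _ hc)⟩, h3, h4, h5⟩
  rcases adj_iff_step.1 h with h | h
  · refine (hP.exists_left hu hv h).2.imp_right ?_
    rintro ⟨c, i, rfl, h1, h2, h3⟩
    obtain ⟨z, hz, hvz, hzu, h4⟩ := third hu hv ⟨_, rfl⟩ h h2 h3
    obtain ⟨_, ⟨d₀, rfl⟩, h5⟩ := hzu.exists_closer_left hu.1
    obtain ⟨d, hd1, hd2, rfl⟩ := exists_intCast_eq_mem_Ico d₀ c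
    have k1 := (closest_iff h hvz hzu _).2 h1
    have k2 := (closest_iff hvz hzu h _).2 h4
    have k3 := (closest_iff hzu h hvz _).2 h5
    have n1 : d ≠ c := by
      rintro rfl
      have := k2.2
      omega
    have n2 : d ≠ c + 1 := by
      rintro rfl
      have := k3.2
      omega
    refine ⟨z, ⟨hu, hv, hz⟩, ⟨h.adj, hvz.adj, hzu.adj⟩, d - n, c, c + 1, by omega, by omega,
      by omega, ?_, k2.symm, k1.symm⟩
    simpa using k3.symm
  · refine (hP.exists_left hv hu h).1.imp_right ?_
    rintro ⟨c, i, rfl, h1, h2, h3⟩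
    obtain ⟨z, hz, huz, hzv, h4⟩ := third hv hu ⟨_, rfl⟩ h h2 h3
    obtain ⟨_, ⟨d₀, rfl⟩, h5⟩ := hzv.exists_closer_left hv.1
    obtain ⟨d, hd1, hd2, rfl⟩ := exists_intCast_eq_mem_Ico d₀ i
    have k1 := (closest_iff h huz hzv _).2 h1
    have k2 := (closest_iff huz hzv h _).2 h4
    have k3 := (closest_iff hzv h huz _).2 h5
    have n1 : d ≠ i := by
      rintro rfl
      have := k1.1
      have := k3.2
      omega
    have n2 : d ≠ i + 1 := by
      rintro rfl
      have := k2.2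
      omega
    exact ⟨z, ⟨hu, hv, hz⟩, ⟨h.adj.symm, hzv.adj.symm, huz.adj.symm⟩, i, i + 1, d, by omega,
      by omega, by omega, k1, k2, k3⟩

/-- There is at most one face to the left of a directed edge. -/
theorem FourPoint.tri_unique [NeZero n] (hP : FourPoint P) {u v w w' : Vertex}
    (h : Tri P u v w) (h' : Tri P u v w') : w = w' := by
  -- The index `c` of `FourPoint.exists_left` depends only on the edge. Every face to the left of
  -- the edge lies towards `P c`, which determines its third vertex.
  have key : ∀ {x y z c}, Step x y → Step y z → Step z x → F c x < F c y → F y c < F x c →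
      ¬ F c x < F c z → F z c < F y c := by
    intro x y z c hxy hyz hzx h1 h2 h3
    have := leftLabel_cases hxy hyz hzx c
    have := rightLabel_cases hxy hyz hzx c
    by_contra hcon
    have h4 := hyz.F_eq_add (a := c) (b := c) (by omega) (by omega)
    have h5 := F_nonneg c z
    have h6 := F_nonneg y c
    rw [F_self] at h4
    omega
  rcases adj_iff_step.1 h.2.1.1 with hs | hs
  · rcases (hP.exists_left h.1.1 h.1.2.1 hs).2 with ⟨i, rfl, rfl⟩ | ⟨c, i, rfl, h1, h2, h3⟩
    · exact absurd h hP.not_tri_bdry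
    · have hc : ∀ w, Tri P u v w → Step v w ∧ Step w u ∧ F w (P c) < F v (P c) := by
        intro w h
        obtain ⟨s1, s2⟩ := hs.third h.2.1.2.1 h.2.1.2.2
        refine ⟨s1, s2, key hs s1 s2 h2 h3 fun hcon => ?_⟩
        refine hP.not_closest_succ h (i := c) ⟨h2, hcon⟩ ?_
        exact (closest_iff hs s1 s2 _).2 (by simpa using h1)
      obtain ⟨a1, a2, a3⟩ := hc w h
      obtain ⟨b1, b2, b3⟩ := hc w' h'
      exact hs.third_unique h3 a2 a1 a3 b2 b1 b3
  · rcases (hP.exists_left h.1.2.1 h.1.1 hs).1 with ⟨i, rfl, rfl⟩ | ⟨c, i, rfl, h1, h2, h3⟩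
    · exact absurd h hP.not_tri_bdry
    · have hc : ∀ w, Tri P u v w → Step u w ∧ Step w v ∧
          F w (P ((i + 1 : ℤ) : ZMod n)) < F u (P ((i + 1 : ℤ) : ZMod n)) := by
        intro w h
        obtain ⟨s1, s2⟩ := hs.third h.2.1.2.2.symm h.2.1.2.1.symm
        refine ⟨s1, s2, key hs s1 s2 h2 h3 fun hcon => ?_⟩
        refine hP.not_closest_succ h (i := i) ((closest_iff hs s1 s2 _).2 h1) ?_
        have : Closest v u w (P ((i + 1 : ℤ) : ZMod n)) := ⟨h2, hcon⟩
        simpa using this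
      obtain ⟨a1, a2, a3⟩ := hc w h
      obtain ⟨b1, b2, b3⟩ := hc w' h'
      exact hs.third_unique h3 a2 a1 a3 b2 b1 b3

open OLattice

/-! ### Links of vertices of the hull -/

/-- Three pairwise adjacent vertices of the hull form a face with one of the two orientations. -/
theorem tri_or_tri [NeZero n] {u v w : Vertex} (hu : u ∈ conv (Set.range P))
    (hv : v ∈ conv (Set.range P)) (hw : w ∈ conv (Set.range P)) (huv : Adj u v) (hvw : Adj v w)
    (hwu : Adj w u) : Tri P u v w ∨ Tri P v u w := by
  have key : ∀ {x y z}, x ∈ conv (Set.range P) → y ∈ conv (Set.range P) →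
      z ∈ conv (Set.range P) → Step x y → Adj y z → Adj z x → Tri P x y z ∨ Tri P y x z := by
    intro x y z hx hy hz hxy hyz hzx
    obtain ⟨hyz, hzx⟩ := hxy.third hyz hzx
    obtain ⟨_, ⟨i, rfl⟩, hi⟩ := hxy.exists_closer_left hy.1
    obtain ⟨_, ⟨j, rfl⟩, hj⟩ := hyz.exists_closer_left hz.1
    obtain ⟨_, ⟨k, rfl⟩, hk⟩ := hzx.exists_closer_left hx.1
    obtain ⟨a, -, -, rfl⟩ := exists_intCast_eq_mem_Ico i 0
    obtain ⟨b, hb, hb', rfl⟩ := exists_intCast_eq_mem_Ico j a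
    obtain ⟨c, hc, hc', rfl⟩ := exists_intCast_eq_mem_Ico k a
    replace hi := (closest_iff hxy hyz hzx _).2 hi
    replace hj := (closest_iff hyz hzx hxy _).2 hj
    replace hk := (closest_iff hzx hxy hyz _).2 hk
    have n1 : a ≠ b := by
      rintro rfl
      have := hi.2
      have := hj.1
      omega
    have n2 : a ≠ c := by
      rintro rfl
      have := hi.1
      have := hk.2
      omega
    have n3 : b ≠ c := by
      rintro rfl
      have := hk.1
      have := hj.2
      omega
    rcases lt_or_gt_of_ne n3 with h | h
    · exact Or.inr ⟨⟨hy, hx, hz⟩, ⟨hxy.adj.symm, hzx.adj.symm, hyz.adj.symm⟩, a, b, c,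
        by omega, h, hc', hi, hj, hk⟩
    · refine Or.inl ⟨⟨hx, hy, hz⟩, ⟨hxy.adj, hyz.adj, hzx.adj⟩, c - n, b - n, a, by omega,
        by omega, by omega, ?_, ?_, hi.symm⟩
      · simpa using hk.symm
      · simpa using hj.symm
  rcases adj_iff_step.1 huv with h | h
  · exact key hu hv hw h hvw hwu
  · exact (key hv hu hw h hwu.symm hvw.symm).symm

/-- An edge at a vertex of the hull off the polygon lies in two triangles of the hull. -/
theorem FourPoint.exists_two_tri [NeZero n] (hP : FourPoint P) {u v : Vertex}
    (hv : v ∈ conv (Set.range P)) (hvP : v ∉ Set.range P) (hu : u ∈ conv (Set.range P))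
    (h : Adj v u) : ∃ w w', w ≠ w' ∧ (w ∈ conv (Set.range P) ∧ Adj u w ∧ Adj w v) ∧
      (w' ∈ conv (Set.range P) ∧ Adj u w' ∧ Adj w' v) := by
  rcases hP.exists_tri hv hu h with ⟨i, hi, -⟩ | ⟨w, hw⟩
  · exact absurd ⟨i, hi⟩ hvP
  rcases hP.exists_tri hu hv h.symm with ⟨i, -, hi⟩ | ⟨w', hw'⟩
  · exact absurd ⟨i + 1, hi⟩ hvP
  refine ⟨w, w', ?_, ⟨hw.1.2.2, hw.2.1.2.1, hw.2.1.2.2⟩,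
    ⟨hw'.1.2.2, hw'.2.1.2.2.symm, hw'.2.1.2.1.symm⟩⟩
  rintro rfl
  exact hP.not_tri_swap hw hw'

/-- Given two triangles on each edge at `v`, there are six neighbours of `v`: three lines and three
points of the projective plane `ℙ(L / t L)`, because the incidence graph of a projective plane
contains no circuit of length four. -/
theorem FourPoint.exists_six [NeZero n] (hP : FourPoint P) {v : Vertex}
    (hv : v ∈ conv (Set.range P)) (hvP : v ∉ Set.range P) :
    ∃ s : Finset Vertex, s.card = 6 ∧ ∀ w ∈ s, w ∈ conv (Set.range P) ∧ Adj v w := by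
  have other : ∀ {u a}, u ∈ conv (Set.range P) → Adj v u → ∃ w, w ≠ a ∧
      w ∈ conv (Set.range P) ∧ Adj u w ∧ Adj w v := by
    intro u a hu h
    obtain ⟨w, w', hne, h1, h2⟩ := hP.exists_two_tri hv hvP hu h
    by_cases hw : w = a
    · exact ⟨w', fun h => hne (hw.trans h.symm), h2⟩
    · exact ⟨w, hw, h1⟩
  have other1 : ∀ {l a}, l ∈ conv (Set.range P) → Step v l → ∃ p, p ≠ a ∧
      p ∈ conv (Set.range P) ∧ Step l p ∧ Step p v := by
    intro l a hl h
    obtain ⟨w, h1, h2, h3, h4⟩ := other (a := a) hl h.adj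
    exact ⟨w, h1, h2, h.third h3 h4⟩
  have other2 : ∀ {p a}, p ∈ conv (Set.range P) → Step p v → ∃ l, l ≠ a ∧
      l ∈ conv (Set.range P) ∧ Step l p ∧ Step v l := by
    intro p a hp h
    obtain ⟨w, h1, h2, h3, h4⟩ := other (a := a) hp h.adj.symm
    obtain ⟨h5, h6⟩ := h.third h4.symm h3.symm
    exact ⟨w, h1, h2, h6, h5⟩
  obtain ⟨l, hl, hvl⟩ : ∃ l ∈ conv (Set.range P), Step v l := by
    obtain ⟨w, hw, h, -⟩ := exists_gate hP.adj hv 0 fun h => hvP ⟨0, h.symm⟩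
    rcases adj_iff_step.1 h with h | h
    · exact ⟨w, hw, h⟩
    · obtain ⟨l, -, h1, -, h2⟩ := other2 (a := v) hw h
      exact ⟨l, h1, h2⟩
  obtain ⟨p₁, -, hp₁, hlp₁, hp₁v⟩ := other1 (a := v) hl hvl
  obtain ⟨p₂, hp₂₁, hp₂, hlp₂, hp₂v⟩ := other1 (a := p₁) hl hvl
  obtain ⟨l₁, hl₁l, hl₁, hl₁p₁, hvl₁⟩ := other2 (a := l) hp₁ hp₁v
  obtain ⟨l₂, hl₂l, hl₂, hl₂p₂, hvl₂⟩ := other2 (a := l) hp₂ hp₂v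
  obtain ⟨q, hqp₁, hq, hl₁q, hqv⟩ := other1 (a := p₁) hl₁ hvl₁
  have h12 : l₁ ≠ l₂ := by
    rintro rfl
    exact hp₂₁ (hvl.third_unique_of_ne hvl₁ hl₁l.symm hlp₂ hl₂p₂ hp₂v hlp₁ hl₁p₁ hp₁v)
  have hqp₂ : q ≠ p₂ := by
    rintro rfl
    exact hp₂₁ (hvl.third_unique_of_ne hvl₁ hl₁l.symm hlp₂ hl₁q hp₂v hlp₁ hl₁p₁ hp₁v)
  have hne : ∀ {a b}, Step v a → Step b v → a ≠ b := by
    rintro a b h1 h2 rfl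
    have := h1.1
    have := h2.2
    omega
  classical
  refine ⟨{l, l₁, l₂, p₁, p₂, q}, ?_, ?_⟩
  · rw [Finset.card_insert_of_notMem, Finset.card_insert_of_notMem, Finset.card_insert_of_notMem,
      Finset.card_insert_of_notMem, Finset.card_insert_of_notMem, Finset.card_singleton]
    · simpa using hqp₂.symm
    · simpa using ⟨hp₂₁.symm, hqp₁.symm⟩
    · simpa using ⟨hne hvl₂ hp₁v, hne hvl₂ hp₂v, hne hvl₂ hqv⟩
    · simpa using ⟨h12, hne hvl₁ hp₁v, hne hvl₁ hp₂v, hne hvl₁ hqv⟩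
    · simpa using ⟨hl₁l.symm, hl₂l.symm, hne hvl hp₁v, hne hvl hp₂v, hne hvl hqv⟩
  · intro w hw
    simp only [Finset.mem_insert, Finset.mem_singleton] at hw
    rcases hw with rfl | rfl | rfl | rfl | rfl | rfl
    · exact ⟨hl, hvl.adj⟩
    · exact ⟨hl₁, hvl₁.adj⟩
    · exact ⟨hl₂, hvl₂.adj⟩
    · exact ⟨hp₁, hp₁v.adj.symm⟩
    · exact ⟨hp₂, hp₂v.adj.symm⟩
    · exact ⟨hq, hqv.adj.symm⟩

/-- For adjacent vertices `a`, `b`, the neighbours of `v` closer to one of them are among those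
closer to the other. -/
theorem closer_nested (v : Vertex) {a b : Vertex} (hab : Adj a b) :
    (∀ w, Adj v w → F w a < F v a → F w b < F v b) ∨
    (∀ w, Adj v w → F w b < F v b → F w a < F v a) := by
  obtain ⟨L, rfl⟩ := exists_cls v
  obtain ⟨A, rfl, hAL, hA⟩ := exists_le_rep L a
  obtain ⟨B, rfl, hBL, hB⟩ := exists_le_rep L b
  have key : ∀ {A B : OLattice}, F (cls L) (cls A) = A.deg - L.deg →
      F (cls L) (cls B) = B.deg - L.deg → B ≤ A →
      ∀ w, Adj (cls L) w → F w (cls A) < F (cls L) (cls A) → F w (cls B) < F (cls L) (cls B) := by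
    intro A B hA hB hBA w hw h
    obtain ⟨W, rfl, h1, h2, h3⟩ := exists_rep_of_closer hA hw h
    have := F_le_iff.2 (hBA.trans ((le_sum_right _ _).trans h2))
    omega
  have hcmp : B ≤ A ∨ A ≤ B := by
    rw [← F_le_iff, ← F_le_iff]
    rcases adj_iff_step.1 hab with h | h
    · have := h.1
      have := h.2
      have := h.F_left_cases (cls L)
      omega
    · have := h.1
      have := h.2
      have := h.F_left_cases (cls L)
      omega
  rcases hcmp with h | h
  · exact Or.inl (key hA hB h)
  · exact Or.inr (key hB hA h)

/-! ### The simplicial complex of the hull -/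

/-- The subcomplex of the building induced on the convex hull of `P`. -/
abbrev hull (P : ZMod n → Vertex) : PreAbstractSimplicialComplex Vertex :=
  Planar.induced building (conv (Set.range P))

theorem isFace_iff {s : Set Vertex} :
    Planar.IsFace (hull P) s ↔ s.Finite ∧ s.Nonempty ∧ s.Pairwise Adj ∧ s ⊆ conv (Set.range P) := by
  constructor
  · rintro ⟨u, ⟨⟨h1, h2⟩, h3⟩, rfl⟩
    exact ⟨u.finite_toSet, h1, h2, h3⟩
  · rintro ⟨h, h1, h2, h3⟩
    refine ⟨h.toFinset, ⟨⟨?_, ?_⟩, ?_⟩, ?_⟩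
    · simpa using h1
    · simpa using h2
    · simpa using h3
    · simp

theorem isFace_singleton {v : Vertex} :
    Planar.IsFace (hull P) {v} ↔ v ∈ conv (Set.range P) := by
  rw [isFace_iff]
  simp

theorem isFace_pair {u v : Vertex} (h : u ≠ v) :
    Planar.IsFace (hull P) {u, v} ↔
      u ∈ conv (Set.range P) ∧ v ∈ conv (Set.range P) ∧ Adj u v := by
  rw [isFace_iff, Set.pairwise_pair, Set.pair_subset_iff]
  constructor
  · rintro ⟨-, -, h1, h2, h3⟩
    exact ⟨h2, h3, (h1 h).1⟩
  · rintro ⟨h1, h2, h3⟩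
    exact ⟨by simp, by simp, fun _ => ⟨h3, h3.symm⟩, h1, h2⟩

theorem finite_hull [NeZero n] : (conv (Set.range P)).Finite :=
  finite_conv (Set.finite_range P) (Set.range_nonempty P)

theorem degree_eq (v : Vertex) (hv : v ∈ conv (Set.range P)) :
    Planar.degree (hull P) v = {w | w ∈ conv (Set.range P) ∧ Adj v w}.ncard := by
  unfold Planar.degree
  congr 1
  ext w
  constructor
  · rintro ⟨h1, h2⟩
    exact ((isFace_pair h1.symm).1 h2).2
  · rintro ⟨h1, h2⟩
    exact ⟨h2.ne.symm, (isFace_pair h2.ne).2 ⟨hv, h1, h2⟩⟩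

theorem FourPoint.isCAT0 [NeZero n] (hP : FourPoint P) : Planar.IsCAT0 (hull P) P := by
  intro v hv hvP
  rw [isFace_singleton] at hv
  obtain ⟨s, hs, hsub⟩ := hP.exists_six hv hvP
  rw [degree_eq v hv, ← hs, ← Set.ncard_coe_finset]
  exact Set.ncard_le_ncard hsub (finite_hull.subset fun w hw => hw.1)

open Equiv.Perm

/-! ### The embedding of the hull in the sphere -/

theorem Dart.mem (d : Planar.Dart (hull P)) :
    d.1.1 ∈ conv (Set.range P) ∧ d.1.2 ∈ conv (Set.range P) ∧ Adj d.1.1 d.1.2 :=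
  (isFace_pair d.2.1).1 d.2.2

/-- The directed edge of the hull from `u` to `v`. -/
def dart {u v : Vertex} (hu : u ∈ conv (Set.range P)) (hv : v ∈ conv (Set.range P))
    (h : Adj u v) : Planar.Dart (hull P) :=
  ⟨(u, v), h.ne, (isFace_pair h.ne).2 ⟨hu, hv, h⟩⟩

theorem Dart.ext {d e : Planar.Dart (hull P)} (h1 : d.1.1 = e.1.1) (h2 : d.1.2 = e.1.2) : d = e :=
  Subtype.ext (Prod.ext h1 h2)

instance [NeZero n] : Finite (Planar.Dart (hull P)) := by
  have : Finite ↑(conv (Set.range P) ×ˢ conv (Set.range P)) := (finite_hull.prod finite_hull)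
  exact Finite.of_injective
    (fun d => (⟨d.1, (Dart.mem d).1, (Dart.mem d).2.1⟩ :
      ↑(conv (Set.range P) ×ˢ conv (Set.range P))))
    fun d e h => Subtype.ext (congrArg (fun p => p.1) h)

namespace FourPoint

/-- The directed edges of the polygon. -/
def bdry (hP : FourPoint P) (i : ZMod n) : Planar.Dart (hull P) :=
  dart (subset_conv _ ⟨i, rfl⟩) (subset_conv _ ⟨i + 1, rfl⟩) (hP.adj i)

theorem bdry_val (hP : FourPoint P) (i : ZMod n) : (hP.bdry i).1 = (P i, P (i + 1)) := rfl

variable [NeZero n] (hP : FourPoint P)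

theorem bdry_injective : Function.Injective hP.bdry := fun _ _ h =>
  hP.bdry_unique (congrArg (fun d => d.1.1) h) (congrArg (fun d => d.1.2) h)

include hP in
theorem notMem_of_tri {d : Planar.Dart (hull P)} {w : Vertex} (h : Tri P d.1.1 d.1.2 w) :
    d ∉ Set.range hP.bdry := by
  rintro ⟨i, rfl⟩
  exact hP.not_tri_bdry h

theorem exists_tri_of_notMem {d : Planar.Dart (hull P)} (h : d ∉ Set.range hP.bdry) :
    ∃ w, Tri P d.1.1 d.1.2 w := by
  obtain ⟨h1, h2, h3⟩ := Dart.mem d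
  rcases hP.exists_tri h1 h2 h3 with ⟨i, h4, h5⟩ | h4
  · exact absurd ⟨i, Dart.ext h4 h5⟩ h
  · exact h4

theorem exists_next (d : Planar.Dart (hull P)) : ∃ e : Planar.Dart (hull P),
    (∀ i, d = hP.bdry i → e = hP.bdry (i + 1)) ∧
    (d ∉ Set.range hP.bdry → e.1.1 = d.1.2 ∧ Tri P d.1.1 d.1.2 e.1.2) := by
  by_cases h : d ∈ Set.range hP.bdry
  · obtain ⟨i, rfl⟩ := h
    exact ⟨hP.bdry (i + 1), fun j hj => by rw [hP.bdry_injective hj],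
      fun h => absurd ⟨i, rfl⟩ h⟩
  · obtain ⟨w, hw⟩ := hP.exists_tri_of_notMem h
    exact ⟨dart hw.1.2.1 hw.1.2.2 hw.2.1.2.1, fun i hi => absurd ⟨i, hi.symm⟩ h,
      fun _ => ⟨rfl, hw⟩⟩

/-- The successor of a directed edge along the face to its left. -/
noncomputable def succ (d : Planar.Dart (hull P)) : Planar.Dart (hull P) :=
  (hP.exists_next d).choose

theorem succ_bdry (i : ZMod n) : hP.succ (hP.bdry i) = hP.bdry (i + 1) :=
  (hP.exists_next (hP.bdry i)).choose_spec.1 i rfl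

theorem succ_fst (d : Planar.Dart (hull P)) : (hP.succ d).1.1 = d.1.2 := by
  by_cases h : d ∈ Set.range hP.bdry
  · obtain ⟨i, rfl⟩ := h
    rw [succ_bdry]
    rfl
  · exact ((hP.exists_next d).choose_spec.2 h).1

theorem tri_succ {d : Planar.Dart (hull P)} (h : d ∉ Set.range hP.bdry) :
    Tri P d.1.1 d.1.2 (hP.succ d).1.2 :=
  ((hP.exists_next d).choose_spec.2 h).2

theorem succ_notMem {d : Planar.Dart (hull P)} (h : d ∉ Set.range hP.bdry) :
    hP.succ d ∉ Set.range hP.bdry := by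
  apply hP.notMem_of_tri (w := d.1.1)
  rw [succ_fst]
  exact (hP.tri_succ h).rotate

theorem succ_of_tri {d e : Planar.Dart (hull P)} {w : Vertex} (h : Tri P d.1.1 d.1.2 w)
    (h1 : e.1.1 = d.1.2) (h2 : e.1.2 = w) : hP.succ d = e := by
  have h3 := hP.tri_succ (hP.notMem_of_tri h)
  exact Dart.ext ((hP.succ_fst d).trans h1.symm) ((hP.tri_unique h3 h).trans h2.symm)

theorem succ_three {d : Planar.Dart (hull P)} (h : d ∉ Set.range hP.bdry) :
    hP.succ (hP.succ (hP.succ d)) = d := by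
  have h1 := (hP.tri_succ h).rotate
  rw [← hP.succ_fst] at h1
  have h2 : (hP.succ (hP.succ d)).1.2 = d.1.1 :=
    hP.tri_unique (hP.tri_succ (hP.succ_notMem h)) h1
  refine hP.succ_of_tri (w := d.1.2) ?_ h2.symm rfl
  rw [h2, hP.succ_fst]
  have := (hP.tri_succ h).rotate.rotate
  exact this

theorem succ_injective : Function.Injective hP.succ := by
  intro d e h
  by_cases hd : d ∈ Set.range hP.bdry
  · by_cases he : e ∈ Set.range hP.bdry
    · obtain ⟨i, rfl⟩ := hd
      obtain ⟨j, rfl⟩ := he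
      rw [succ_bdry, succ_bdry] at h
      rw [add_right_cancel (hP.bdry_injective h)]
    · obtain ⟨i, rfl⟩ := hd
      refine absurd ?_ (hP.succ_notMem he)
      rw [← h, succ_bdry]
      exact ⟨_, rfl⟩
  · by_cases he : e ∈ Set.range hP.bdry
    · obtain ⟨i, rfl⟩ := he
      refine absurd ?_ (hP.succ_notMem hd)
      rw [h, succ_bdry]
      exact ⟨_, rfl⟩
    · rw [← hP.succ_three hd, h, hP.succ_three he]

/-- The permutation of the directed edges whose cycles are the faces: the polygon and the
triangles. -/
noncomputable def next : Equiv.Perm (Planar.Dart (hull P)) :=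
  Equiv.ofBijective hP.succ (Finite.injective_iff_bijective.1 hP.succ_injective)

theorem next_apply (d : Planar.Dart (hull P)) : hP.next d = hP.succ d := rfl

/-- Rotation around the vertices of the hull. -/
noncomputable def rot : Equiv.Perm (Planar.Dart (hull P)) := hP.next * Planar.rev (hull P)

theorem rot_fst (d : Planar.Dart (hull P)) : (hP.rot d).1.1 = d.1.1 := hP.succ_fst _

/-! ### Turning around a vertex -/

theorem sameCycle_rot_of_adj {d e : Planar.Dart (hull P)} (h : d.1.1 = e.1.1)
    (h1 : Adj d.1.2 e.1.2) : hP.rot.SameCycle d e := by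
  obtain ⟨⟨v, w⟩, hd⟩ := d
  obtain ⟨⟨v', w'⟩, he⟩ := e
  obtain rfl : v = v' := h
  have hd' := Dart.mem (P := P) ⟨(v, w), hd⟩
  have he' := Dart.mem (P := P) ⟨(v, w'), he⟩
  rcases tri_or_tri hd'.2.1 hd'.1 he'.2.1 hd'.2.2.symm he'.2.2 h1.symm with h2 | h2
  · have : hP.rot ⟨(v, w), hd⟩ = ⟨(v, w'), he⟩ := hP.succ_of_tri h2 rfl rfl
    rw [← this]
    exact (SameCycle.refl _ _).apply_right
  · have : hP.rot ⟨(v, w'), he⟩ = ⟨(v, w), hd⟩ := hP.succ_of_tri h2.rotate.rotate rfl rfl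
    rw [← this]
    exact (SameCycle.refl _ _).apply_left

theorem sameCycle_rot_of_closer {d e : Planar.Dart (hull P)} (h : d.1.1 = e.1.1) {j : ZMod n}
    (hd : F d.1.2 (P j) < F d.1.1 (P j)) (he : F e.1.2 (P j) < F e.1.1 (P j)) :
    hP.rot.SameCycle d e := by
  have hne : d.1.1 ≠ P j := by
    intro h0
    rw [h0, F_self] at hd
    have := F_nonneg d.1.2 (P j)
    omega
  have hm := Dart.mem d
  have hm' := Dart.mem e
  obtain ⟨w, hw, hvw, -, hstar, -⟩ := exists_gate hP.adj hm.1 j hne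
  have key : ∀ f : Planar.Dart (hull P), f.1.1 = d.1.1 → F f.1.2 (P j) < F f.1.1 (P j) →
      hP.rot.SameCycle (dart hm.1 hw hvw) f := by
    intro f hf1 hf2
    have hf := Dart.mem f
    rw [hf1] at hf2
    rcases hstar f.1.2 hf.2.1 (hf1 ▸ hf.2.2) hf2 with h1 | h1
    · rw [show dart hm.1 hw hvw = f from Dart.ext hf1.symm h1.symm]
    · exact hP.sameCycle_rot_of_adj hf1.symm h1.symm
  exact (key d rfl hd).symm.trans (key e h.symm he)

omit hP [NeZero n] in
theorem exists_closer (d : Planar.Dart (hull P)) : ∃ j, F d.1.2 (P j) < F d.1.1 (P j) := by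
  obtain ⟨_, ⟨j, rfl⟩, hj⟩ := exists_F_eq_add (Dart.mem d).2.1.2 d.1.1
  have h1 := F_nonneg d.1.1 d.1.2
  have h2 : F d.1.1 d.1.2 ≠ 0 := fun h => d.2.1 (F_eq_zero_iff.1 h)
  exact ⟨j, by omega⟩

/-- All directed edges leaving a vertex `v` lie in one cycle of the rotation. The edges leading
closer to `P j` do, because they form a star; the stars for `P j` and `P (j + 1)` are nested if
both differ from `v`; and if the walk `P` passes through `v`, the rotation takes the edge back
along `P` to the next edge of `P`. -/
theorem rot_cycle (d e : Planar.Dart (hull P)) (h : d.1.1 = e.1.1) : hP.rot.SameCycle d e := by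
  -- `C j`: the cycle of `d` contains the edges leading closer to `P j`, or, at `P j` itself, the edge
  -- to `P (j + 1)`.
  let C : ZMod n → Prop := fun j =>
    (d.1.1 ≠ P j → ∀ f : Planar.Dart (hull P), f.1.1 = d.1.1 →
      F f.1.2 (P j) < F f.1.1 (P j) → hP.rot.SameCycle d f) ∧
    (d.1.1 = P j → hP.rot.SameCycle d (hP.bdry j))
  have hm := Dart.mem d
  have step : ∀ j, C j → C (j + 1) := by
    rintro j ⟨h1, h2⟩
    constructor
    · intro hne f hf1 hf2
      by_cases hj : d.1.1 = P j
      · refine (h2 hj).trans (hP.sameCycle_rot_of_closer (j := j + 1) (hf1.trans hj).symm ?_ hf2)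
        rw [bdry_val]
        simp only
        rw [F_self]
        exact lt_of_le_of_ne (F_nonneg _ _) fun h => (hP.adj j).ne (F_eq_zero_iff.1 h.symm)
      · rcases closer_nested d.1.1 (hP.adj j) with h3 | h3
        · obtain ⟨w, hw, hvw, hlt, -⟩ := exists_gate hP.adj hm.1 j hj
          refine (h1 hj (dart hm.1 hw hvw) rfl hlt).trans
            (hP.sameCycle_rot_of_closer (j := j + 1) hf1.symm (h3 _ hvw hlt) hf2)
        · refine h1 hj f hf1 ?_
          rw [hf1] at hf2 ⊢
          exact h3 _ (hf1 ▸ (Dart.mem f).2.2) hf2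
    · intro hj
      have hj' : d.1.1 ≠ P j := fun h => (hP.adj j).ne (h.symm.trans hj)
      have h3 := h1 hj' (Planar.rev _ (hP.bdry j)) hj.symm (by
        change F (P j) (P j) < F (P (j + 1)) (P j)
        rw [F_self]
        exact lt_of_le_of_ne (F_nonneg _ _) fun h => (hP.adj j).ne (F_eq_zero_iff.1 h.symm).symm)
      have h4 : hP.rot (Planar.rev _ (hP.bdry j)) = hP.bdry (j + 1) := hP.succ_bdry j
      rw [← h4]
      exact h3.apply_right
  have ne : ∀ f : Planar.Dart (hull P), ∀ j, F f.1.2 (P j) < F f.1.1 (P j) → f.1.1 ≠ P j := by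
    intro f j h1 h0
    rw [h0, F_self] at h1
    have := F_nonneg f.1.2 (P j)
    omega
  obtain ⟨j, hj⟩ := exists_closer d
  have hC : ∀ k : ℕ, C (j + k) := by
    intro k
    induction k with
    | zero =>
      rw [Nat.cast_zero, add_zero]
      exact ⟨fun _ f hf1 hf2 => hP.sameCycle_rot_of_closer hf1.symm hj hf2,
        fun h => absurd h (ne d j hj)⟩
    | succ k ih =>
      rw [Nat.cast_succ, ← add_assoc]
      exact step _ ih
  obtain ⟨i, hi⟩ := exists_closer e
  have hCi := hC (i - j).val
  rw [ZMod.natCast_zmod_val, add_sub_cancel] at hCi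
  exact hCi.1 (h ▸ ne e i hi) e h.symm hi

theorem sameCycle_rot_iff {d e : Planar.Dart (hull P)} :
    hP.rot.SameCycle d e ↔ d.1.1 = e.1.1 := by
  refine ⟨?_, hP.rot_cycle d e⟩
  intro h
  obtain ⟨k, -, rfl⟩ := h.exists_pow_eq'
  induction k with
  | zero => rfl
  | succ k ih =>
    rw [pow_succ', mul_apply, rot_fst]
    exact ih ⟨k, by simp⟩

/-! ### The triangles -/

/-- The vertices of the triangle to the left of a directed edge; for an edge of the polygon, the
empty set. -/
def leftFace (d : Planar.Dart (hull P)) : Set Vertex :=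
  {x | d ∉ Set.range hP.bdry ∧ (x = d.1.1 ∨ x = d.1.2 ∨ x = (hP.succ d).1.2)}

theorem leftFace_bdry (i : ZMod n) : hP.leftFace (hP.bdry i) = ∅ := by
  ext x
  simp [leftFace]

theorem leftFace_of_notMem {d : Planar.Dart (hull P)} (h : d ∉ Set.range hP.bdry) :
    hP.leftFace d = {d.1.1, d.1.2, (hP.succ d).1.2} := by
  ext x
  simp [leftFace, h]

theorem succ_succ_snd {d : Planar.Dart (hull P)} (h : d ∉ Set.range hP.bdry) :
    (hP.succ (hP.succ d)).1.2 = d.1.1 := by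
  rw [← hP.succ_fst, hP.succ_three h]

theorem leftFace_succ (d : Planar.Dart (hull P)) : hP.leftFace (hP.succ d) = hP.leftFace d := by
  by_cases h : d ∈ Set.range hP.bdry
  · obtain ⟨i, rfl⟩ := h
    rw [succ_bdry, leftFace_bdry, leftFace_bdry]
  · rw [leftFace_of_notMem _ h, leftFace_of_notMem _ (hP.succ_notMem h), succ_fst,
      hP.succ_succ_snd h]
    ext x
    simp only [Set.mem_insert_iff, Set.mem_singleton_iff]
    tauto

theorem eq_of_leftFace_eq {d e : Planar.Dart (hull P)} (hd : d ∉ Set.range hP.bdry)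
    (he : e ∉ Set.range hP.bdry) (h : hP.leftFace d = hP.leftFace e) (h1 : d.1.1 = e.1.1) :
    d = e := by
  rw [leftFace_of_notMem _ hd, leftFace_of_notMem _ he] at h
  have h2 := hP.tri_succ hd
  have h3 := hP.tri_succ he
  have h4 : d.1.2 ∈ ({e.1.1, e.1.2, (hP.succ e).1.2} : Set Vertex) := h ▸ by simp
  have h5 : (hP.succ d).1.2 ∈ ({e.1.1, e.1.2, (hP.succ e).1.2} : Set Vertex) := h ▸ by simp
  have h6 := h2.2.1.1.ne
  have h7 := h2.2.1.2.1.ne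
  have h8 := h2.2.1.2.2.ne
  rw [h1] at h6 h8
  rcases h4 with h4 | h4 | h4
  · exact absurd h4.symm h6
  · exact Dart.ext h1 h4
  · rcases h5 with h5 | h5 | h5
    · exact absurd h5 h8
    · rw [h1, h4, h5] at h2
      exact (hP.not_tri_swap h3 h2.rotate.rotate).elim
    · exact absurd (h4.trans h5.symm) h7

theorem sameCycle_next_iff {d e : Planar.Dart (hull P)} :
    hP.next.SameCycle d e ↔ hP.leftFace d = hP.leftFace e := by
  constructor
  · intro h
    obtain ⟨k, -, rfl⟩ := h.exists_pow_eq'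
    induction k with
    | zero => rfl
    | succ k ih =>
      rw [pow_succ', mul_apply, next_apply, leftFace_succ]
      exact ih ⟨k, by simp⟩
  · intro h
    by_cases hd : d ∈ Set.range hP.bdry
    · obtain ⟨i, rfl⟩ := hd
      by_cases he : e ∈ Set.range hP.bdry
      · obtain ⟨j, rfl⟩ := he
        have key : ∀ k : ℕ, hP.next.SameCycle (hP.bdry i) (hP.bdry (i + k)) := by
          intro k
          induction k with
          | zero => simpa using SameCycle.refl _ _
          | succ k ih =>
            rw [Nat.cast_succ, ← add_assoc, ← succ_bdry, ← next_apply]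
            exact ih.apply_right
        have := key (j - i).val
        rwa [ZMod.natCast_zmod_val, add_sub_cancel] at this
      · rw [leftFace_bdry, leftFace_of_notMem _ he] at h
        exact absurd h.symm (Set.insert_nonempty _ _).ne_empty
    · by_cases he : e ∈ Set.range hP.bdry
      · obtain ⟨j, rfl⟩ := he
        rw [leftFace_bdry, leftFace_of_notMem _ hd] at h
        exact absurd h (Set.insert_nonempty _ _).ne_empty
      · have h1 : d.1.1 ∈ hP.leftFace e := h ▸ ⟨hd, Or.inl rfl⟩
        have e1 : hP.next.SameCycle (hP.succ e) e := (SameCycle.refl _ e).apply_left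
        rcases h1.2 with h2 | h2 | h2
        · rw [hP.eq_of_leftFace_eq hd he h h2]
        · rw [hP.eq_of_leftFace_eq hd (hP.succ_notMem he) (h.trans (hP.leftFace_succ e).symm)
            (h2.trans (hP.succ_fst e).symm)]
          exact e1
        · rw [hP.eq_of_leftFace_eq hd (hP.succ_notMem (hP.succ_notMem he))
            (h.trans ((hP.leftFace_succ _).trans (hP.leftFace_succ e)).symm)
            (h2.trans (hP.succ_fst _).symm)]
          exact e1.apply_left

end FourPoint

/-- A flag of the building has at most three vertices, because adjacent vertices have different
types. -/
theorem card_le_three {s : Finset Vertex} (hs : (s : Set Vertex).Pairwise Adj) : s.card ≤ 3 := by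
  rcases s.eq_empty_or_nonempty with rfl | ⟨o, -⟩
  · simp
  have h : Set.InjOn (fun x => F o x % 3) s := by
    intro x hx y hy hxy
    by_contra hne
    have h1 := adj_iff_step.1 (hs hx hy hne)
    have h2 := F_cocycle o x y
    have h3 : F o x % 3 = F o y % 3 := hxy
    rcases h1 with h1 | h1
    · have := h1.1
      omega
    · have := h1.2
      omega
  have := Finset.card_le_card_of_injOn (t := Finset.Ico (0 : ℤ) 3) _
    (fun x _ => Finset.mem_coe.2 (Finset.mem_Ico.2 ⟨by omega, by omega⟩)) h
  simpa using this

/-! ### Euler's formula -/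

theorem card_quotient_sameCycle {D X : Type} {f : Equiv.Perm D} (φ : D → X)
    (h : ∀ d e, f.SameCycle d e ↔ φ d = φ e) :
    Nat.card (Quotient (SameCycle.setoid f)) = (Set.range φ).ncard := by
  rw [← Nat.card_coe_set_eq]
  refine Nat.card_congr (Equiv.ofBijective (Quotient.lift (fun d => ⟨φ d, d, rfl⟩)
    fun d e hde => Subtype.ext ((h d e).1 hde)) ⟨?_, ?_⟩)
  · intro x y
    refine Quotient.inductionOn₂ x y fun d e hde => ?_
    exact Quotient.sound ((h d e).2 (congrArg Subtype.val hde))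
  · rintro ⟨_, d, rfl⟩
    exact ⟨Quotient.mk _ d, rfl⟩

theorem reflTransGen_of_sameCycle {D : Type} [Finite D] {f : Equiv.Perm D} {R : D → D → Prop}
    (h : ∀ d, Relation.ReflTransGen R d (f d)) {d e : D} (hde : f.SameCycle d e) :
    Relation.ReflTransGen R d e := by
  obtain ⟨k, -, rfl⟩ := hde.exists_pow_eq'
  induction k with
  | zero => exact .refl
  | succ k ih =>
    rw [pow_succ', mul_apply]
    exact (ih ⟨k, by simp⟩).trans (h _)

/-- Adjacent vertices have different distances to a given vertex. -/
theorem Adj.F_ne {x y : Vertex} (h : Adj x y) (b : Vertex) : F x b ≠ F y b := by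
  rcases adj_iff_step.1 h with h | h <;>
  · have := h.F_right_cases b
    omega

namespace FourPoint

variable [NeZero n] (hP : FourPoint P)

theorem exists_dart (hP : FourPoint P) {v : Vertex} (hv : v ∈ conv (Set.range P)) :
    ∃ d : Planar.Dart (hull P), d.1.1 = v := by
  by_cases h : v = P 0
  · exact ⟨hP.bdry 0, h.symm⟩
  · obtain ⟨w, hw, h1, -⟩ := exists_gate hP.adj hv 0 h
    exact ⟨dart hv hw h1, rfl⟩

/-- The hull is connected: every vertex has a neighbour closer to `P 0`. -/
theorem forall_dart_rel (hP : FourPoint P)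
    {r : Planar.Dart (hull P) → Planar.Dart (hull P) → Prop} (hr : Equivalence r)
    (hrev : ∀ d, r d (Planar.rev _ d)) (hrot : ∀ d e, d.1.1 = e.1.1 → r d e)
    (d e : Planar.Dart (hull P)) : r d e := by
  have key : ∀ m : ℕ, ∀ d : Planar.Dart (hull P), F d.1.1 (P 0) ≤ m → r d (hP.bdry 0) := by
    intro m
    induction m with
    | zero =>
      intro d hd
      have := F_nonneg d.1.1 (P 0)
      exact hrot _ _ (F_eq_zero_iff.1 (le_antisymm (by simpa using hd) this) : d.1.1 = P 0)
    | succ m ih =>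
      intro d hd
      by_cases h : d.1.1 = P 0
      · exact hrot _ _ h
      · obtain ⟨w, hw, h1, h2, -⟩ := exists_gate hP.adj (Dart.mem d).1 0 h
        refine hr.trans (hrot d (dart (Dart.mem d).1 hw h1) rfl) (hr.trans (hrev _) (ih _ ?_))
        change F w (P 0) ≤ m
        omega
  have key' : ∀ d, r d (hP.bdry 0) := fun d =>
    key (F d.1.1 (P 0)).toNat d (Int.self_le_toNat _)
  exact hr.trans (key' d) (hr.symm (key' e))

theorem reflTransGen_rev_rot (d e : Planar.Dart (hull P)) :
    Relation.ReflTransGen (fun a b => b = Planar.rev _ a ∨ b = hP.rot a) d e := by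
  have hs : ∀ d e : Planar.Dart (hull P), d.1.1 = e.1.1 →
      Relation.ReflTransGen (fun a b => b = Planar.rev _ a ∨ b = hP.rot a) d e := fun d e h =>
    reflTransGen_of_sameCycle (f := hP.rot) (fun d => .single (Or.inr rfl)) (hP.rot_cycle d e h)
  refine hP.forall_dart_rel ⟨fun _ => .refl, ?_, fun h1 h2 => h1.trans h2⟩
    (fun d => .single (Or.inl rfl)) hs d e
  intro x y h
  induction h with
  | refl => exact .refl
  | tail _ h ih =>
    refine .trans ?_ ih
    rcases h with rfl | rfl
    · exact .single (Or.inl rfl)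
    · exact hs _ _ (hP.rot_fst _)

theorem reflTransGen_rev_next (d e : Planar.Dart (hull P)) :
    Relation.ReflTransGen (fun a b => b = Planar.rev _ a ∨ b = hP.next a) d e := by
  have h := hP.reflTransGen_rev_rot d e
  induction h with
  | refl => exact .refl
  | tail _ h ih =>
    refine ih.trans ?_
    rcases h with rfl | rfl
    · exact .single (Or.inl rfl)
    · exact .tail (b := Planar.rev _ _) (.single (Or.inl rfl)) (Or.inr rfl)

/-- Every vertex `v` other than `o = P 0` has a distinguished neighbour closer to `o`. The edges
from `v` to its other closer neighbours correspond to the triangles in which `v` is the vertex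
farthest from `o`. -/
theorem euler : Nat.card (Quotient (SameCycle.setoid hP.rot)) +
      Nat.card (Quotient (SameCycle.setoid hP.next)) =
    Nat.card (Quotient (SameCycle.setoid (Planar.rev (hull P)))) + 2 := by
  classical
  set o := P 0
  have hgate : ∀ v, v ∈ conv (Set.range P) → v ≠ o → _ := fun v hv hne =>
    exists_gate hP.adj hv 0 hne
  have : Nonempty Vertex := ⟨o⟩
  choose! g hg using hgate
  have top_ne : ∀ d : Planar.Dart (hull P), F d.1.2 o < F d.1.1 o → d.1.1 ≠ o := by
    intro d hd h
    rw [h, F_self] at hd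
    have := F_nonneg d.1.2 o
    omega
  let down : Set (Planar.Dart (hull P)) := {d | F d.1.2 o < F d.1.1 o}
  have hV : Nat.card (Quotient (SameCycle.setoid hP.rot)) = (conv (Set.range P)).ncard := by
    rw [card_quotient_sameCycle (fun d : Planar.Dart (hull P) => d.1.1)
      fun d e => hP.sameCycle_rot_iff]
    congr 1
    ext v
    exact ⟨by rintro ⟨d, rfl⟩; exact (Dart.mem d).1, fun hv => hP.exists_dart hv⟩
  have hE : Nat.card (Quotient (SameCycle.setoid (Planar.rev (hull P)))) = down.ncard := by
    have hlt : ∀ d ∉ down, Planar.rev _ d ∈ down := fun d hd =>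
      lt_of_le_of_ne (not_lt.1 hd) ((Dart.mem d).2.2.F_ne o)
    have hlt' : ∀ d ∈ down, Planar.rev _ d ∉ down := fun d (hd : F d.1.2 o < F d.1.1 o) =>
      not_lt.2 (le_of_lt hd : F d.1.2 o ≤ F d.1.1 o)
    have hrev : ∀ d e, (Planar.rev (hull P)).SameCycle d e ↔ e = d ∨ e = Planar.rev _ d := by
      intro d e
      constructor
      · intro h
        obtain ⟨k, -, rfl⟩ := h.exists_pow_eq'
        induction k with
        | zero => exact Or.inl rfl
        | succ k ih =>
          rw [pow_succ', mul_apply]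
          rcases ih ⟨k, by simp⟩ with h | h
          · rw [h]
            exact Or.inr rfl
          · rw [h]
            exact Or.inl rfl
      · rintro (rfl | rfl)
        · exact SameCycle.refl _ _
        · exact (SameCycle.refl _ _).apply_right
    rw [card_quotient_sameCycle (fun d => if d ∈ down then d else Planar.rev _ d)]
    · congr 1
      ext d
      constructor
      · rintro ⟨d, rfl⟩
        by_cases h : d ∈ down
        · simp [h]
        · simpa [h] using hlt d h
      · intro h
        exact ⟨d, if_pos h⟩
    · intro d e
      rw [hrev]
      constructor
      · rintro (rfl | rfl)
        · rfl
        · by_cases h : d ∈ down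
          · simp only [if_pos h, if_neg (hlt' d h)]
            rfl
          · simp only [if_neg h, if_pos (hlt d h)]
      · intro h
        by_cases hd : d ∈ down <;> by_cases he : e ∈ down <;>
          simp only [hd, he, if_true, if_false] at h
        · exact Or.inl h.symm
        · exact Or.inr (by rw [h]; rfl)
        · exact Or.inr h.symm
        · exact Or.inl ((Planar.rev (hull P)).injective h.symm)
  let tops : Set (Planar.Dart (hull P)) := {d | d ∈ down ∧ d.1.2 = g d.1.1}
  let sides : Set (Planar.Dart (hull P)) := {d | d ∈ down ∧ d.1.2 ≠ g d.1.1}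
  have hsplit : down.ncard = tops.ncard + sides.ncard := by
    rw [← Set.ncard_union_eq]
    · congr 1
      ext d
      simp only [tops, sides, Set.mem_union, Set.mem_ofPred_eq]
      tauto
    · rw [Set.disjoint_left]
      exact fun d h1 h2 => h2.2 h1.2
  have htops : tops.ncard + 1 = (conv (Set.range P)).ncard := by
    have hmem : o ∈ conv (Set.range P) := subset_conv _ ⟨0, rfl⟩
    rw [← Set.ncard_sdiff_singleton_add_one hmem finite_hull]
    congr 1
    refine Set.ncard_congr (fun d _ => d.1.1) ?_ ?_ ?_
    · rintro d ⟨h1, -⟩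
      exact ⟨(Dart.mem d).1, top_ne d h1⟩
    · rintro d e ⟨-, h1⟩ ⟨-, h2⟩ h
      exact Dart.ext h (by rw [h1, h2, h])
    · rintro v ⟨hv, hne⟩
      obtain ⟨h1, h2, h3, -⟩ := hg v hv hne
      exact ⟨dart hv h1 h2, ⟨h3, rfl⟩, rfl⟩
  have hF : Nat.card (Quotient (SameCycle.setoid hP.next)) = sides.ncard + 1 := by
    rw [card_quotient_sameCycle hP.leftFace fun d e => hP.sameCycle_next_iff]
    have hmem : (∅ : Set Vertex) ∈ Set.range hP.leftFace := ⟨_, hP.leftFace_bdry 0⟩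
    rw [← Set.ncard_sdiff_singleton_add_one hmem (Set.toFinite _)]
    congr 1
    symm
    have hside : ∀ d ∈ sides, g d.1.1 ∈ conv (Set.range P) ∧ Adj d.1.1 (g d.1.1) ∧
        Adj d.1.2 (g d.1.1) ∧ F (g d.1.1) o < F d.1.1 o := by
      rintro d ⟨h1, h2⟩
      obtain ⟨h3, h4, h5, h6, -⟩ := hg d.1.1 (Dart.mem d).1 (top_ne d h1)
      exact ⟨h3, h4, (h6 d.1.2 (Dart.mem d).2.1 (Dart.mem d).2.2 h1).resolve_left h2, h5⟩
    have highest : ∀ {u v a b : Vertex}, F a o < F v o → F b o < F v o →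
        u ∈ ({v, a, b} : Set Vertex) → u = v ∨ F u o < F v o := by
      rintro u v a b h1 h2 (rfl | rfl | rfl)
      exacts [Or.inl rfl, Or.inr h1, Or.inr h2]
    refine Set.ncard_congr (fun d _ => {d.1.1, d.1.2, g d.1.1}) ?_ ?_ ?_
    · intro d hd
      obtain ⟨h1, h2, h3, -⟩ := hside d hd
      refine ⟨?_, (Set.insert_nonempty _ _).ne_empty⟩
      have h4 := Dart.mem d
      rcases tri_or_tri h4.1 h4.2.1 h1 h4.2.2 h3 h2.symm with h | h
      · refine ⟨d, ?_⟩
        rw [hP.leftFace_of_notMem (hP.notMem_of_tri h),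
          hP.tri_unique (hP.tri_succ (hP.notMem_of_tri h)) h]
      · have h' : Planar.rev _ d ∉ Set.range hP.bdry := hP.notMem_of_tri h
        refine ⟨Planar.rev _ d, ?_⟩
        rw [hP.leftFace_of_notMem h', hP.tri_unique (hP.tri_succ h') h]
        exact Set.insert_comm _ _ _
    · intro d e hd he h
      obtain ⟨-, -, -, h1⟩ := hside d hd
      obtain ⟨-, -, -, h2⟩ := hside e he
      have h3 := hd.1
      have h4 := he.1
      simp only [down, Set.mem_ofPred_eq] at h3 h4
      have h5 : d.1.1 ∈ ({e.1.1, e.1.2, g e.1.1} : Set Vertex) := h ▸ by simp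
      have h6 : e.1.1 ∈ ({d.1.1, d.1.2, g d.1.1} : Set Vertex) := h ▸ by simp
      have h7 : d.1.2 ∈ ({e.1.1, e.1.2, g e.1.1} : Set Vertex) := h ▸ by simp
      have h8 : d.1.1 = e.1.1 := by
        rcases highest h4 h2 h5 with h | h
        · exact h
        rcases highest h3 h1 h6 with h' | h'
        · exact h'.symm
        · exact absurd h (lt_asymm h')
      refine Dart.ext h8 ?_
      rcases h7 with h7 | h7 | h7
      · exact absurd (h8.trans h7.symm) (Dart.mem d).2.2.ne
      · exact h7
      · exact absurd (h7.trans (by rw [h8])) hd.2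
    · have key : ∀ {u v w}, Tri P u v w → F v o < F u o → F w o < F u o →
          ∃ d, ∃ _ : d ∈ sides, ({d.1.1, d.1.2, g d.1.1} : Set Vertex) = {u, v, w} := by
        rintro u v w ⟨⟨hu, hv, hw⟩, ⟨huv, hvw, hwu⟩, -⟩ h1 h2
        obtain ⟨-, -, -, -, h3⟩ := hg u hu (top_ne (dart hu hv huv) h1)
        rcases h3 v hv w hw huv hwu.symm h1 h2 hvw with h | h
        · refine ⟨dart hu hw hwu.symm, ⟨h2, ?_⟩, ?_⟩
          · exact fun h' => hvw.ne (h.trans h'.symm)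
          · change ({u, w, g u} : Set Vertex) = _
            rw [← h, Set.pair_comm w v]
        · refine ⟨dart hu hv huv, ⟨h1, ?_⟩, ?_⟩
          · exact fun h' => hvw.ne (h'.trans h.symm)
          · change ({u, v, g u} : Set Vertex) = _
            rw [← h]
      rintro _ ⟨⟨d, rfl⟩, hne⟩
      have hd : d ∉ Set.range hP.bdry := by
        rintro ⟨i, rfl⟩
        exact hne (hP.leftFace_bdry i)
      rw [hP.leftFace_of_notMem hd]
      have h := hP.tri_succ hd
      have h1 := h.2.1.1.F_ne o
      have h2 := h.2.1.2.1.F_ne o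
      have h3 := h.2.1.2.2.F_ne o
      generalize d.1.1 = u at *
      generalize d.1.2 = v at *
      generalize (hP.succ d).1.2 = w at *
      by_cases hu : F v o < F u o ∧ F w o < F u o
      · exact key h hu.1 hu.2
      by_cases hv : F w o < F v o ∧ F u o < F v o
      · obtain ⟨d, hd, h4⟩ := key h.rotate hv.1 hv.2
        refine ⟨d, hd, h4.trans ?_⟩
        rw [Set.pair_comm w u, Set.insert_comm]
      · obtain ⟨d, hd, h4⟩ := key h.rotate.rotate (by omega) (by omega)
        refine ⟨d, hd, h4.trans ?_⟩
        rw [Set.insert_comm, Set.pair_comm w v]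
  omega

theorem isPlanarMap_rot : Planar.IsPlanarMap (Planar.rev (hull P)) hP.rot where
  finite := inferInstance
  flip_flip _ := rfl
  flip_ne d h := d.2.1 (congrArg (fun e => e.1.2) h)
  connected := hP.reflTransGen_rev_rot
  euler := by
    have h : hP.rot * Planar.rev (hull P) = hP.next := rfl
    rw [h]
    exact hP.euler

theorem isPlanarMap_next : Planar.IsPlanarMap (Planar.rev (hull P)) hP.next where
  finite := inferInstance
  flip_flip _ := rfl
  flip_ne d h := d.2.1 (congrArg (fun e => e.1.2) h)
  connected := hP.reflTransGen_rev_next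
  euler := by
    have h := hP.euler
    rw [add_comm]
    exact h

/-! ### The diskoid and its dual web -/

/-- The hull as a triangulated diskoid with boundary `P`. -/
noncomputable def diskoid : Planar.TriangulatedDiskoid (hull P) P where
  next := hP.next
  next_fst := hP.succ_fst
  bdry := hP.bdry
  bdry_val _ := rfl
  bdry_injective := hP.bdry_injective
  next_bdry := hP.succ_bdry
  next_three _ h := hP.succ_three h
  isFace d h := by
    obtain ⟨⟨h1, h2, h3⟩, ⟨h4, h5, h6⟩, -⟩ := hP.tri_succ h
    rw [isFace_iff]
    refine ⟨Set.toFinite _, Set.insert_nonempty _ _, ?_, ?_⟩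
    · rintro x (rfl | rfl | rfl) y (rfl | rfl | rfl) hne
      · exact absurd rfl hne
      · exact h4
      · exact h6.symm
      · exact h4.symm
      · exact absurd rfl hne
      · exact h5
      · exact h6
      · exact h5.symm
      · exact absurd rfl hne
    · rintro x (rfl | rfl | rfl)
      · exact h1
      · exact h2
      · exact h3
  exists_triangle s hs hcard := by
    classical
    obtain ⟨⟨-, hadj⟩, hsub⟩ := hs
    obtain ⟨x, y, z, hxy, hxz, hyz, rfl⟩ := Finset.card_eq_three.1 hcard
    simp only [Finset.coe_insert, Finset.coe_singleton] at hadj hsub ⊢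
    have hx := hsub (show x ∈ ({x, y, z} : Set Vertex) by simp)
    have hy := hsub (show y ∈ ({x, y, z} : Set Vertex) by simp)
    have hz := hsub (show z ∈ ({x, y, z} : Set Vertex) by simp)
    have hxy' : Adj x y := hadj (by simp) (by simp) hxy
    have hyz' : Adj y z := hadj (by simp) (by simp) hyz
    have hzx' : Adj z x := hadj (by simp) (by simp) hxz.symm
    rcases tri_or_tri hx hy hz hxy' hyz' hzx' with h | h
    · have hd : dart hx hy hxy' ∉ Set.range hP.bdry := hP.notMem_of_tri h
      refine ⟨dart hx hy hxy', hd, ?_⟩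
      rw [hP.next_apply, hP.tri_unique (hP.tri_succ hd) h]
      rfl
    · have hd : dart hy hx hxy'.symm ∉ Set.range hP.bdry := hP.notMem_of_tri h
      refine ⟨dart hy hx hxy'.symm, hd, ?_⟩
      rw [hP.next_apply, hP.tri_unique (hP.tri_succ hd) h]
      exact Set.insert_comm _ _ _
  triangle_unique d e hd he h := by
    rw [hP.next_apply, hP.next_apply, ← hP.leftFace_of_notMem hd, ← hP.leftFace_of_notMem he] at h
    exact hP.sameCycle_next_iff.2 h
  card_le s hs := card_le_three hs.1.2
  exists_dart v hv := hP.exists_dart (isFace_singleton.1 hv)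
  rot_cycle := hP.rot_cycle
  planar := hP.isPlanarMap_rot

theorem succ_mem_iff {d : Planar.Dart (hull P)} :
    hP.succ d ∈ Set.range hP.bdry ↔ d ∈ Set.range hP.bdry := by
  constructor
  · intro h
    by_contra hd
    exact hP.succ_notMem hd h
  · rintro ⟨i, rfl⟩
    exact ⟨i + 1, (hP.succ_bdry i).symm⟩

open Classical in
/-- Rotation around the vertices of the dual web: it follows the triangles of the diskoid, and fixes
the directed edges of the polygon. -/
noncomputable def webRot : Equiv.Perm (Planar.Dart (hull P)) where
  toFun d := if d ∈ Set.range hP.bdry then d else hP.next d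
  invFun d := if d ∈ Set.range hP.bdry then d else hP.next.symm d
  left_inv d := by
    by_cases h : d ∈ Set.range hP.bdry
    · simp only [if_pos h]
    · have h1 : hP.next d ∉ Set.range hP.bdry := fun h2 => h (hP.succ_mem_iff.1 h2)
      simp only [if_neg h, if_neg h1, Equiv.symm_apply_apply]
  right_inv d := by
    by_cases h : d ∈ Set.range hP.bdry
    · simp only [if_pos h]
    · have h1 : hP.next.symm d ∉ Set.range hP.bdry := fun h2 => h (by
        have := hP.succ_mem_iff.2 h2
        rwa [← next_apply, Equiv.apply_symm_apply] at this)
      simp only [if_neg h, if_neg h1, Equiv.apply_symm_apply]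

theorem webRot_bdry (i : ZMod n) : hP.webRot (hP.bdry i) = hP.bdry i := if_pos ⟨i, rfl⟩

theorem webRot_of_notMem {d : Planar.Dart (hull P)} (h : d ∉ Set.range hP.bdry) :
    hP.webRot d = hP.succ d := if_neg h

theorem sameCycle_webRot {d e : Planar.Dart (hull P)} (h : hP.webRot.SameCycle d e) :
    d = e ∨ d ∉ Set.range hP.bdry ∧ e ∉ Set.range hP.bdry ∧ hP.leftFace d = hP.leftFace e := by
  by_cases hd : d ∈ Set.range hP.bdry
  · obtain ⟨i, rfl⟩ := hd
    exact Or.inl (h.eq_of_left (hP.webRot_bdry i))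
  · right
    refine ⟨hd, ?_⟩
    obtain ⟨k, -, rfl⟩ := h.exists_pow_eq'
    induction k with
    | zero => exact ⟨hd, rfl⟩
    | succ k ih =>
      obtain ⟨h1, h2⟩ := ih ⟨k, by simp⟩
      rw [pow_succ', mul_apply, webRot_of_notMem _ h1, leftFace_succ]
      exact ⟨hP.succ_notMem h1, h2⟩

theorem step_succ_iff {d : Planar.Dart (hull P)} (h : d ∉ Set.range hP.bdry) :
    Step (hP.succ d).1.2 (hP.succ d).1.1 ↔ Step d.1.2 d.1.1 := by
  obtain ⟨h4, h5, h6⟩ := (hP.tri_succ h).2.1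
  rw [hP.succ_fst]
  exact ⟨fun hs => (hs.third h4.symm h6.symm).1, fun hs => (hs.third h6.symm h5.symm).2⟩

/-- Two edges of the dual web with the same end points are equal, since the two triangles on an edge
of the diskoid share no further edge. -/
theorem web_simple (d e : Planar.Dart (hull P)) (h : hP.webRot.SameCycle d e)
    (h' : hP.webRot.SameCycle (Planar.rev _ d) (Planar.rev _ e)) : d = e := by
  rcases hP.sameCycle_webRot h with h | ⟨hd, he, h1⟩
  · exact h
  rcases hP.sameCycle_webRot h' with h' | ⟨hd', he', h2⟩
  · exact (Planar.rev _).injective h'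
  by_contra hne
  have hw : (hP.succ d).1.2 = e.1.1 ∨ (hP.succ d).1.2 = e.1.2 := by
    have h3 : e.1.1 ∈ hP.leftFace d := h1 ▸ ⟨he, Or.inl rfl⟩
    rcases h3.2 with h3 | h3 | h3
    · exact absurd (hP.eq_of_leftFace_eq hd he h1 h3.symm) hne
    · rw [hP.eq_of_leftFace_eq (hP.succ_notMem hd) he ((hP.leftFace_succ d).trans h1)
        ((hP.succ_fst d).trans h3.symm)]
      exact Or.inr rfl
    · exact Or.inl h3.symm
  have hw' : (hP.succ d).1.2 ∈ hP.leftFace (Planar.rev _ d) := by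
    rw [h2]
    exact ⟨he', hw.symm.imp id Or.inl⟩
  have h3 := hP.tri_succ hd
  have h4 : Tri P d.1.2 d.1.1 (hP.succ (Planar.rev _ d)).1.2 := hP.tri_succ hd'
  rcases hw'.2 with h5 | h5 | h5
  · exact h3.2.1.2.1.ne h5.symm
  · exact h3.2.1.2.2.ne h5
  · rw [← h5] at h4
    exact hP.not_tri_swap h3 h4

/-- The web dual to the hull. Its half-edges are the directed edges of the hull. -/
noncomputable def web : Planar.Web n where
  HalfEdge := Planar.Dart (hull P)
  flip := Planar.rev (hull P)
  rot := hP.webRot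
  out d := HasDist d.1.1 d.1.2 omega1
  out_flip d := by
    rw [hasDist_omega1_iff, hasDist_omega1_iff]
    change Step d.1.1 d.1.2 ↔ _
    rcases adj_iff_step.1 (Dart.mem d).2.2 with h | h
    · exact iff_of_true h fun h' => by
        have := h.1
        have := h'.2
        omega
    · exact iff_of_false (fun h' => by
        have := h.1
        have := h'.2
        omega) fun h' => h' h
  bdry := hP.bdry
  bdry_injective := hP.bdry_injective
  rot_bdry := hP.webRot_bdry
  trivalent d h := by
    have h1 := hP.succ_notMem h
    rw [webRot_of_notMem _ h, webRot_of_notMem _ h1, webRot_of_notMem _ (hP.succ_notMem h1)]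
    refine ⟨fun h2 => d.2.1 ?_, hP.succ_three h⟩
    rw [← hP.succ_fst d, h2]
  out_rot d := by
    by_cases h : d ∈ Set.range hP.bdry
    · obtain ⟨i, rfl⟩ := h
      rw [webRot_bdry]
    · rw [webRot_of_notMem _ h, hasDist_omega1_iff, hasDist_omega1_iff]
      exact hP.step_succ_iff h
  simple := hP.web_simple
  closedRot := hP.next
  closedRot_bdry := hP.succ_bdry
  closedRot_of_notMem d h := (hP.webRot_of_notMem h).symm
  planar := hP.isPlanarMap_next

theorem isDual_web : hP.diskoid.IsDual (fun x y => HasDist x y omega1) hP.web :=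
  ⟨Equiv.refl _, fun _ => rfl, fun _ => rfl, fun _ h => (hP.webRot_of_notMem h).symm,
    fun _ => Iff.rfl⟩

/-- The faces of the dual web are the vertices of the hull, and the number of sides of a face is the
degree of the vertex. -/
theorem nonElliptic_web : hP.web.NonElliptic := by
  change ∀ d : Planar.Dart (hull P), (∀ e, hP.rot.SameCycle d e → e ∉ Set.range hP.bdry) →
    6 ≤ {e | hP.rot.SameCycle d e}.ncard
  intro d hd
  have hm := (Dart.mem d).1
  have hdP : d.1.1 ∉ Set.range P := by
    rintro ⟨i, hi⟩
    exact hd (hP.bdry i) (hP.rot_cycle _ _ hi.symm) ⟨i, rfl⟩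
  refine (hP.isCAT0 d.1.1 (isFace_singleton.2 hm) hdP).trans (le_of_eq ?_)
  rw [degree_eq d.1.1 hm]
  refine (Set.ncard_congr (fun e _ => e.1.2) ?_ ?_ ?_).symm
  · intro e he
    have h := hP.sameCycle_rot_iff.1 he
    exact ⟨(Dart.mem e).2.1, h ▸ (Dart.mem e).2.2⟩
  · intro e f he hf h
    exact Dart.ext ((hP.sameCycle_rot_iff.1 he).symm.trans (hP.sameCycle_rot_iff.1 hf)) h
  · rintro w ⟨hw, h⟩
    exact ⟨dart hm hw h, hP.rot_cycle _ _ rfl, rfl⟩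

end FourPoint

end A2

theorem mainTheorem2 (n : ℕ) (hn : 1 ≤ n) (P : ZMod n → A2.Vertex)
    (hP : A2.IsPolygon P) (hgen : A2.IsGeneric P) :
    Planar.IsCAT0 (Planar.induced A2.building (A2.conv (Set.range P))) P ∧
    ∃ T : Planar.TriangulatedDiskoid
        (Planar.induced A2.building (A2.conv (Set.range P))) P,
      ∃ W : Planar.Web n,
        T.IsDual (fun x y => A2.HasDist x y A2.omega1) W ∧ W.NonElliptic := by
  have : NeZero n := ⟨Nat.one_le_iff_ne_zero.1 hn⟩
  have h := A2.fourPoint_of_isGeneric hP hgen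
  exact ⟨h.isCAT0, h.diskoid, h.web, h.isDual_web, h.nonElliptic_web⟩
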